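/- Let $(V,\|\cdot\|)$ be a strictly convex normed plane, i.e. a two-dimensional real normed space whose unit circle contains no non-degenerate segment, and let $P\subset V$ be a finite set with at least two points. **Notions.** $R(P)=\inf_{x\in V}\max_{p\in P}\|x-p\|$ is the minimal enclosing radius and $C(P)=\{x:\max_{p\in P}\|x-p\|=R(P)\}$ the set of centers of minimal enclosing disks. The bisector of $p,q$ is $\mathrm{bisec}(p,q)=\{x:\|x-p\|=\|x-q\|\}$. A triangle is a set $\{v,a,b\}$ of three distinct points. It is norm-acute, norm-right or norm-obtuse *at the vertex* $v$ according as $\bigl\|v-\tfrac{a+b}{2}\bigr\|$ is $>$, $=$ or $<$ $\tfrac12\|a-b\|$. A triangle is *norm-obtuse* (respectively *norm-right*) if it is norm-obtuse (respectively norm-right) at one vertex and norm-acute at the other two, and *norm-acute* if it is norm-acute at all three vertices. **Algorithm (Elzinga–Hearn), input $P$.** 1. Choose distinct $p_1,p_2\in P$. 2. Put $\bar x:=\frac12(p_1+p_2)$, $\bar\lambda:=\frac12\|p_1-p_2\|$. If $\|\bar x-p\|\le\bar\lambda$ for all $p\in P$, return $(\bar x,\bar\lambda)$. Otherwise choose $p_3\in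 P$ with $\|\bar x-p_3\|>\bar\lambda$. 3. If the triangle $\{p_1,p_2,p_3\}$ is norm-obtuse or norm-right, with norm-obtuse or norm-right vertex $p_i$, put $\{p_1,p_2\}:=\{p_1,p_2,p_3\}\setminus\{p_i\}$ and go to step 2. Otherwise let $\bar x$ be the unique point of $\mathrm{bisec}(p_1,p_2)\cap\mathrm{bisec}(p_2,p_3)$ and put $\bar\lambda:=\|\bar x-p_1\|$. 4. If $\|\bar x-p\|\le\bar\lambda$ for all $p\in P$, return $(\bar x,\bar\lambda)$. Otherwise choose $p_4\in P$ with $\|\bar x-p_4\|>\bar\lambda$, and choose $p_5\in\{p_1,p_2,p_3\}$ with $\|p_4-p_5\|=\max_{i=1,2,3}\|p_4-p_i\|$. If $p_4$ does not lie on the straight line $L$ through $p_5$ and $\bar x$, let $p_6$ be the unique point of $\{p_1,p_2,p_3\}\setminus\{p_5\}$ that lies strictly on the side of $L$ opposite to $p_4$; if $p_4\in L$, choose $p_6\in\{p_1,p_2,p_3\}\setminus\{p_5\}$ arbitrarily. Put $\{p_1,p_2,p_3\}:=\{p_4,p_5,p_6\}$ and go to step 3. **Theorem.** For every way of making the choices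 in the algorithm (including the labelling of unordered pairs and triples), the following hold: * every step can be carried out (the required points exist, and the points described as unique exist and are unique); * the algorithm terminates after finitely many steps; * the returned pair $(\bar x,\bar\lambda)$ is the center and the radius of the minimal enclosing disk of $P$, that is, $C(P)=\{\bar x\}$ and $R(P)=\bar\lambda$; * whenever a circumdisk is computed in step 3, the triangle $\{p_1,p_2,p_3\}$ is norm-acute; * the radii $\bar\lambda$ of the candidate disks (two-point disks of step 2 and circumdisks of step 3) strictly increase in the course of the run. -/

import Mathlib

namespace NormedPlane

variable {V : Type*} [NormedAddCommGroup V] [NormedSpace ℝ V]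

/-- The largest distance from `x` to a point of the finite set `P` (for nonempty `P`). -/
noncomputable def maxDist (P : Finset V) (x : V) : ℝ :=
  ⨆ p : P, ‖x - (p : V)‖

/-- The optimal value `R(P)` of the minimal enclosing disk problem. -/
noncomputable def optRadius (P : Finset V) : ℝ :=
  ⨅ x : V, maxDist P x

/-- The set `C(P)` of optimal solutions (centers) of the minimal enclosing disk problem. -/
def optCenters (P : Finset V) : Set V :=
  {x | maxDist P x = optRadius P}

/-- The bisector of two points. -/
def bisec (p q : V) : Set V :=
  {x | ‖x - p‖ = ‖x - q‖}

/-! Triangles are sets of exactly three points; they may be collinear. -/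

/-- `T` is a triangle with vertex `v` at which it is norm-acute. -/
def NormAcuteAt (T : Set V) (v : V) : Prop :=
  ∃ a b : V, v ≠ a ∧ v ≠ b ∧ a ≠ b ∧ T = {v, a, b} ∧
    ‖v - (1 / 2 : ℝ) • (a + b)‖ > ‖a - b‖ / 2

/-- `T` is a triangle with vertex `v` at which it is norm-right. -/
def NormRightAt (T : Set V) (v : V) : Prop :=
  ∃ a b : V, v ≠ a ∧ v ≠ b ∧ a ≠ b ∧ T = {v, a, b} ∧
    ‖v - (1 / 2 : ℝ) • (a + b)‖ = ‖a - b‖ / 2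

/-- `T` is a triangle with vertex `v` at which it is norm-obtuse. -/
def NormObtuseAt (T : Set V) (v : V) : Prop :=
  ∃ a b : V, v ≠ a ∧ v ≠ b ∧ a ≠ b ∧ T = {v, a, b} ∧
    ‖v - (1 / 2 : ℝ) • (a + b)‖ < ‖a - b‖ / 2

/-- A norm-obtuse triangle with its norm-obtuse vertex `v`:
it is norm-obtuse at `v` and norm-acute at the other two vertices. -/
def NormObtuseWith (T : Set V) (v : V) : Prop :=
  NormObtuseAt T v ∧ ∀ w ∈ T, w ≠ v → NormAcuteAt T w

/-- A norm-right triangle with its norm-right vertex `v`: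
it is norm-right at `v` and norm-acute at the other two vertices. -/
def NormRightWith (T : Set V) (v : V) : Prop :=
  NormRightAt T v ∧ ∀ w ∈ T, w ≠ v → NormAcuteAt T w

/-- A norm-acute triangle: norm-acute at all three vertices. -/
def NormAcute (T : Set V) : Prop :=
  T.ncard = 3 ∧ ∀ v ∈ T, NormAcuteAt T v

/-- The states of the Elzinga–Hearn algorithm: a position in the program together with the values of
the variables that are still needed there. -/
inductive State (V : Type*) : Type _
  /-- before the first line -/
  | start : State V
  /-- about to compute the two-point disk of `p₁, p₂` -/
  | pair (p₁ p₂ : V) : State V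
  /-- the two-point disk of `p₁, p₂` has center `x` and radius `r`; about to test it -/
  | pairDisk (p₁ p₂ : V) (x : V) (r : ℝ) : State V
  /-- about to classify the triangle `{p₁, p₂, p₃}` -/
  | tri (p₁ p₂ p₃ : V) : State V
  /-- the circumdisk of `{p₁, p₂, p₃}` has center `x` and radius `r`; about to test it -/
  | triDisk (p₁ p₂ p₃ : V) (x : V) (r : ℝ) : State V
  /-- the algorithm has returned `(x, r)` -/
  | returned (x : V) (r : ℝ) : State V

/-- The candidate disk (center and radius) that is tested in the given state, if any. -/
def State.candidate? {V : Type*} : State V → Option (V × ℝ)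
  | .pairDisk _ _ x r => some (x, r)
  | .triDisk _ _ _ x r => some (x, r)
  | _ => none

/-- One step of the Elzinga–Hearn algorithm on the input `P`. Every choice the algorithm leaves open
is a nondeterministic choice here, including the labelling of unordered pairs and triples. An
assignment `{y} ← A` can only be executed if the set `A` is a singleton. -/
inductive Step (P : Finset V) : State V → State V → Prop
  | choosePair (p₁ p₂ : V) (h₁ : p₁ ∈ P) (h₂ : p₂ ∈ P) (hne : p₁ ≠ p₂) :
      Step P .start (.pair p₁ p₂)
  | twoPointDisk (p₁ p₂ : V) :
      Step P (.pair p₁ p₂) (.pairDisk p₁ p₂ ((1 / 2 : ℝ) • (p₁ + p₂)) ((1 / 2 : ℝ) * ‖p₁ - p₂‖))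
  | returnPair (p₁ p₂ x : V) (r : ℝ) (hall : ∀ p ∈ P, ‖x - p‖ ≤ r) :
      Step P (.pairDisk p₁ p₂ x r) (.returned x r)
  | chooseThird (p₁ p₂ x : V) (r : ℝ) (p₃ : V) (h₃ : p₃ ∈ P) (hout : ‖x - p₃‖ > r) :
      Step P (.pairDisk p₁ p₂ x r) (.tri p₁ p₂ p₃)
  | dropVertex (p₁ p₂ p₃ v q₁ q₂ : V)
      (htype : NormObtuseWith {p₁, p₂, p₃} v ∨ NormRightWith {p₁, p₂, p₃} v)
      (hq : ({q₁, q₂} : Set V) = {p₁, p₂, p₃} \ {v}) :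
      Step P (.tri p₁ p₂ p₃) (.pair q₁ q₂)
  | circumdisk (p₁ p₂ p₃ x : V)
      (htype : ¬ ∃ v, NormObtuseWith {p₁, p₂, p₃} v ∨ NormRightWith {p₁, p₂, p₃} v)
      (hx : bisec p₁ p₂ ∩ bisec p₂ p₃ = {x}) :
      Step P (.tri p₁ p₂ p₃) (.triDisk p₁ p₂ p₃ x ‖x - p₁‖)
  | returnTri (p₁ p₂ p₃ x : V) (r : ℝ) (hall : ∀ p ∈ P, ‖x - p‖ ≤ r) :
      Step P (.triDisk p₁ p₂ p₃ x r) (.returned x r)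
  | exchangeOff (p₁ p₂ p₃ x : V) (r : ℝ) (p₄ p₅ p₆ q₁ q₂ q₃ : V)
      (h₄ : p₄ ∈ P) (hout : ‖x - p₄‖ > r)
      (h₅ : p₅ ∈ ({p₁, p₂, p₃} : Set V))
      (hmax : ∀ p ∈ ({p₁, p₂, p₃} : Set V), ‖p₄ - p‖ ≤ ‖p₄ - p₅‖)
      (hline : p₄ ∉ line[ℝ, p₅, x])
      (h₆ : {p ∈ ({p₁, p₂, p₃} : Set V) \ {p₅} | (line[ℝ, p₅, x]).SOppSide p₄ p} = {p₆})
      (hq : ({q₁, q₂, q₃} : Set V) = {p₄, p₅, p₆}) :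
      Step P (.triDisk p₁ p₂ p₃ x r) (.tri q₁ q₂ q₃)
  | exchangeOn (p₁ p₂ p₃ x : V) (r : ℝ) (p₄ p₅ p₆ q₁ q₂ q₃ : V)
      (h₄ : p₄ ∈ P) (hout : ‖x - p₄‖ > r)
      (h₅ : p₅ ∈ ({p₁, p₂, p₃} : Set V))
      (hmax : ∀ p ∈ ({p₁, p₂, p₃} : Set V), ‖p₄ - p‖ ≤ ‖p₄ - p₅‖)
      (hline : p₄ ∈ line[ℝ, p₅, x])
      (h₆ : p₆ ∈ ({p₁, p₂, p₃} : Set V) \ {p₅})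
      (hq : ({q₁, q₂, q₃} : Set V) = {p₄, p₅, p₆}) :
      Step P (.triDisk p₁ p₂ p₃ x r) (.tri q₁ q₂ q₃)

/-- The states that occur in some run of the algorithm on the input `P`. -/
def Reachable (P : Finset V) (s : State V) : Prop :=
  Relation.ReflTransGen (Step P) .start s

end NormedPlane

/-!
All distances are compared through one notion, `IsMinDisk S x r`: the disk with center `x` and
radius `r` is the only disk of radius at most `r` that encloses `S`. Two-point disks have this
property by strict convexity. So does a circumdisk whose center is a convex combination of the
points on its boundary (`eq_zero_of_norm_sub_le_three`): in a plane, the opposite of any displacement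
of the center lies in a cone spanned by two of the points, as seen from the center, and then the
distance to one of these two increases, by the monotonicity lemma `norm_lt_norm_translate`.

A norm-acute triangle has exactly one circumcenter, and it lies in the interior. For existence, take
a point minimizing the largest distance to the vertices: if only two vertices were extremal, or if
one of the radii lay in the cone spanned by the other two, the radius could be decreased. Uniqueness
follows from `norm_sub_lt_norm_sub_of_cone`: a point of the cone spanned by `u` and `-w`, with
`‖u‖ = ‖w‖`, is closer to `u` than to `w`. Since at most one vertex of a triangle can fail to be
norm-acute, every triangle is norm-acute, norm-right or norm-obtuse, and every candidate disk is the
minimal enclosing disk of the points at hand.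

It remains to see that the radius of the minimal enclosing disk grows. This is clear when a point
outside of the disk is added and none is removed, and dropping the norm-obtuse or norm-right vertex
changes nothing because the two-point disk contains it. In the exchange step, choose the center as
the origin and write `p₄ = a p₅ - b p₆` with `b ≥ 0`, as `p₆` is not on the side of `p₄`. If `a > 0`,
then `p₄` would be closer to `p₅` than to `p₆`, although `p₅` is farthest; so `a ≤ 0`, the old center
is a convex combination of `p₄`, `p₅`, `p₆`, and no disk of the old radius encloses these points
(`exists_lt_of_exchange`). As the candidate radii increase and each of them is determined by a
subset of `P`, the algorithm terminates.
-/

namespace NormedPlane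

/-! ### Norm inequalities for vectors on a common circle -/

section Vectors

variable {E : Type*} [NormedAddCommGroup E] [NormedSpace ℝ E]
  {r : ℝ} {u w c : E}

/-- Two vectors of equal length with a nontrivial nonnegative linear relation are opposite. -/
lemma eq_neg_of_smul_add_smul_eq_zero (hr : 0 < r) (hu : ‖u‖ = r) (hw : ‖w‖ = r) {s t : ℝ}
    (hs : 0 ≤ s) (ht : 0 ≤ t) (hst : 0 < s + t) (h : s • u + t • w = 0) : w = -u := by
  have h1 : s • u = -(t • w) := eq_neg_of_add_eq_zero_left h
  have h2 : s = t := by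
    have := congrArg norm h1
    rw [norm_neg, norm_smul, norm_smul, Real.norm_of_nonneg hs, Real.norm_of_nonneg ht, hu,
      hw] at this
    exact mul_right_cancel₀ hr.ne' this
  subst h2
  have hs' : s ≠ 0 := by intro h; rw [h] at hst; simp at hst
  rw [← smul_add, smul_eq_zero_iff_right hs'] at h
  exact (neg_eq_of_add_eq_zero_right h).symm

lemma eq_or_eq_neg_of_smul_add_smul_eq_zero (hr : 0 < r) (hu : ‖u‖ = r) (hw : ‖w‖ = r) {s t : ℝ}
    (hst : s ≠ 0 ∨ t ≠ 0) (h : s • u + t • w = 0) : u = w ∨ w = -u := by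
  wlog hs : 0 ≤ s generalizing s t
  · exact this (s := -s) (t := -t) (by simpa using hst)
      (by rw [neg_smul, neg_smul, ← neg_add, h, neg_zero]) (by linarith)
  rcases le_or_gt 0 t with ht | ht
  · right
    refine eq_neg_of_smul_add_smul_eq_zero hr hu hw hs ht ?_ h
    rcases hst with h0 | h0
    · have := lt_of_le_of_ne hs h0.symm
      linarith
    · have := lt_of_le_of_ne ht h0.symm
      linarith
  · left
    have := eq_neg_of_smul_add_smul_eq_zero hr hu ((norm_neg w).trans hw) hs
      (neg_nonneg.2 ht.le) (by linarith) (by rw [neg_smul_neg, h])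
    exact (neg_injective this).symm

lemma linearIndependent_pair_of_norm_eq (hr : 0 < r) (hu : ‖u‖ = r) (hw : ‖w‖ = r)
    (h₁ : u ≠ w) (h₂ : w ≠ -u) : LinearIndependent ℝ ![u, w] := by
  rw [LinearIndependent.pair_iff]
  intro s t h
  by_contra hst
  rcases eq_or_eq_neg_of_smul_add_smul_eq_zero hr hu hw
    (by rwa [← not_and_or]) h with h | h
  exacts [h₁ h, h₂ h]

variable [StrictConvexSpace ℝ E]

/-- Inside the cone spanned by two vectors of equal length, translation in the direction of their
sum increases the norm. -/
lemma norm_lt_norm_translate (hu : ‖u‖ = r) (hw : ‖w‖ = r) (hne : u + w ≠ 0) {p q s : ℝ}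
    (hp : 0 ≤ p) (hq : 0 ≤ q) (hs : 0 < s) :
    ‖p • u + q • w‖ < ‖(p + s) • u + (q + s) • w‖ := by
  wlog hqp : q ≤ p generalizing u w p q
  · have := this hw hu (by rwa [add_comm]) hq hp (by linarith)
    rwa [add_comm (q • w), add_comm ((q + s) • w)] at this
  rcases eq_or_lt_of_le hqp with rfl | hlt
  · have hpos : 0 < ‖u + w‖ := norm_pos_iff.2 hne
    rw [← smul_add, ← smul_add, norm_smul, norm_smul, Real.norm_of_nonneg hp,
      Real.norm_of_nonneg (by linarith)]
    nlinarith
  -- The points `((p - q) / 2) • (u - w)`, `(p - q) • u`, `p • u + q • w` and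
  -- `(p + s) • u + (q + s) • w` follow each other on a line, and the norm, a convex function,
  -- is smaller at the first than at the second.
  obtain ⟨d, rfl⟩ : ∃ d, p = q + d := ⟨p - q, by ring⟩
  have hd : 0 < d := by linarith
  set N := ‖(q + d + s) • u + (q + s) • w‖
  have hh : ‖(d / 2) • (u - w)‖ < d * r := by
    have h := norm_combo_lt_of_ne hu.le ((norm_neg w).trans hw).le
      (fun h => hne (by rw [h]; simp)) (half_pos one_pos) (half_pos one_pos) (add_halves (1 : ℝ))
    have he : (d / 2) • (u - w) = d • ((1 / 2 : ℝ) • u + (1 / 2 : ℝ) • (-w)) := by module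
    rw [he, norm_smul, Real.norm_of_nonneg hd.le]
    exact mul_lt_mul_of_pos_left h hd
  have hD : 0 < q + s + d / 2 := by linarith
  have hdu : (q + s + d / 2) * (d * r) ≤ d / 2 * N + (q + s) * ‖(d / 2) • (u - w)‖ := by
    have he : (q + s + d / 2) • d • u
        = (d / 2) • ((q + d + s) • u + (q + s) • w) + (q + s) • (d / 2) • (u - w) := by module
    have := norm_add_le ((d / 2) • ((q + d + s) • u + (q + s) • w))
      ((q + s) • (d / 2) • (u - w))
    rw [← he, norm_smul, norm_smul d, norm_smul (d / 2), norm_smul (q + s),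
      Real.norm_of_nonneg hD.le, Real.norm_of_nonneg hd.le, Real.norm_of_nonneg (half_pos hd).le,
      Real.norm_of_nonneg (by linarith), hu] at this
    exact this
  have hN : d * r < N := by
    have : (q + s) * ‖(d / 2) • (u - w)‖ < (q + s) * (d * r) :=
      mul_lt_mul_of_pos_left hh (by linarith)
    nlinarith
  have hz : (q + s + d / 2) * ‖(q + d) • u + q • w‖
      ≤ (q + d / 2) * N + s * ‖(d / 2) • (u - w)‖ := by
    have he : (q + s + d / 2) • ((q + d) • u + q • w)
        = (q + d / 2) • ((q + d + s) • u + (q + s) • w) + s • (d / 2) • (u - w) := by module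
    have := norm_add_le ((q + d / 2) • ((q + d + s) • u + (q + s) • w))
      (s • (d / 2) • (u - w))
    rw [← he, norm_smul, norm_smul (q + d / 2), norm_smul s,
      Real.norm_of_nonneg hD.le, Real.norm_of_nonneg (by linarith),
      Real.norm_of_nonneg hs.le] at this
    exact this
  have : s * ‖(d / 2) • (u - w)‖ < s * N := mul_lt_mul_of_pos_left (hh.trans hN) hs
  refine lt_of_mul_lt_mul_left (lt_of_le_of_lt hz ?_) hD.le
  linarith

/-- A nonzero point of the cone spanned by `u` and `-w`, where `u ≠ w` have equal length, is
closer to `u` than to `w`. -/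
lemma norm_sub_lt_norm_sub_of_cone (hu : ‖u‖ = r) (hw : ‖w‖ = r) (hne : u ≠ w) {a b : ℝ}
    (ha : 0 ≤ a) (hb : 0 ≤ b) (hab : 0 < a + b) :
    ‖a • u - b • w - u‖ < ‖a • u - b • w - w‖ := by
  have hray : ∀ {s t : ℝ}, 0 < s → 0 < t → ¬ SameRay ℝ (s • u) (t • w) := by
    intro s t hs ht h
    have h' := (h.pos_smul_left (inv_pos.2 hs)).pos_smul_right (inv_pos.2 ht)
    rw [inv_smul_smul₀ hs.ne', inv_smul_smul₀ ht.ne'] at h'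
    exact hne (h'.eq_of_norm_eq (hu.trans hw.symm))
  rcases le_or_gt 1 a with h1 | h1
  · have := norm_lt_norm_translate hu ((norm_neg w).trans hw)
      (fun h => hne (by rwa [← sub_eq_add_neg, sub_eq_zero] at h))
      (p := a - 1) (q := b) (s := 1) (by linarith) hb one_pos
    convert this using 2 <;> module
  have e1 : a • u - b • w - u = -((1 - a) • u + b • w) := by module
  have e2 : a • u - b • w - w = -((1 + b) • w - a • u) := by module
  have n1 : ‖(1 - a) • u‖ = (1 - a) * r := by
    rw [norm_smul, Real.norm_of_nonneg (by linarith), hu]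
  have n2 : ‖b • w‖ = b * r := by rw [norm_smul, Real.norm_of_nonneg hb, hw]
  have n3 : ‖(1 + b) • w‖ = (1 + b) * r := by
    rw [norm_smul, Real.norm_of_nonneg (by linarith), hw]
  have n4 : ‖a • u‖ = a * r := by rw [norm_smul, Real.norm_of_nonneg ha, hu]
  rw [e1, e2, norm_neg, norm_neg]
  rcases eq_or_lt_of_le ha with rfl | ha'
  · have := norm_add_lt_of_not_sameRay (hray (s := 1 - 0) (t := b) (by norm_num) (by linarith))
    rw [zero_smul, sub_zero ((1 + b) • w), n3]
    linarith
  · have h := lt_norm_sub_of_not_sameRay (fun h => hray ha' (t := 1 + b) (by linarith) h.symm)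
    have := norm_add_le ((1 - a) • u) (b • w)
    linarith

/-- If `c` lies in the cone spanned by `u` and `-w` and is equidistant from `u` and `w`,
then it vanishes. -/
lemma eq_zero_of_cone_of_norm_sub_eq (hu : ‖u‖ = r) (hw : ‖w‖ = r) (hne : u ≠ w) {a b : ℝ}
    (ha : 0 ≤ a) (hb : 0 ≤ b) (hc : c = a • u - b • w) (h : ‖c - u‖ = ‖c - w‖) : c = 0 := by
  rcases eq_or_lt_of_le (add_nonneg ha hb) with h0 | h0
  · rw [hc, show a = 0 by linarith, show b = 0 by linarith]
    simp
  · rw [hc] at h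
    exact absurd h (norm_sub_lt_norm_sub_of_cone hu hw hne ha hb h0).ne

lemma eq_zero_of_norm_sub_le_of_norm_add_le (hu : ‖u‖ = r) (h₁ : ‖u - c‖ ≤ r)
    (h₂ : ‖u + c‖ ≤ r) : c = 0 := by
  by_contra hc
  have h := norm_combo_lt_of_ne h₁ h₂
    (fun h => hc (by
      have : (2 : ℝ) • c = 0 := by
        rw [two_smul]
        calc c + c = (u + c) - (u - c) := by abel
          _ = 0 := by rw [h, sub_self]
      simpa using this))
    (half_pos one_pos) (half_pos one_pos) (add_halves (1 : ℝ))
  rw [show (1 / 2 : ℝ) • (u - c) + (1 / 2 : ℝ) • (u + c) = u by module, hu] at h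
  exact lt_irrefl _ h

/-- Moving the center of a disk with boundary points `u` and `w` by a nonzero vector `c` whose
opposite lies in the cone spanned by `u` and `w` increases the distance to `u` or to `w`. -/
lemma eq_zero_of_neg_mem_cone (hr : 0 < r) (hu : ‖u‖ = r) (hw : ‖w‖ = r)
    (huc : ‖u - c‖ ≤ r) (hwc : ‖w - c‖ ≤ r) {α β : ℝ} (hα : 0 ≤ α) (hβ : 0 ≤ β)
    (hc : -c = α • u + β • w) : c = 0 := by
  by_cases hne : u + w = 0
  · refine eq_zero_of_norm_sub_le_of_norm_add_le hu huc ?_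
    rw [show w = -u from (neg_eq_of_add_eq_zero_right hne).symm] at hwc
    rwa [← norm_neg, show -(u + c) = -u - c by abel]
  wlog hβα : β ≤ α generalizing u w α β
  · exact this hw hu hwc huc hβ hα (by rw [hc, add_comm]) (by rwa [add_comm]) (by linarith)
  have e : u - c = (1 + α - β + β) • u + (0 + β) • w := by
    rw [sub_eq_add_neg, hc]; module
  have n : ‖(1 + α - β) • u + (0 : ℝ) • w‖ = (1 + α - β) * r := by
    rw [zero_smul, add_zero, norm_smul, Real.norm_of_nonneg (by linarith), hu]
  rcases eq_or_lt_of_le hβ with rfl | hβ'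
  · have hα0 : α = 0 := by
      rw [e] at huc
      simp only [add_zero, sub_zero] at huc n
      rw [n] at huc
      nlinarith
    simpa [hα0] using hc
  · have := norm_lt_norm_translate hu hw hne (p := 1 + α - β) (q := 0) (by linarith) le_rfl hβ'
    rw [← e, n] at this
    nlinarith

end Vectors

section Plane

variable {V : Type*} [NormedAddCommGroup V] [NormedSpace ℝ V]

lemma exists_eq_smul_add_smul (hdim : Module.finrank ℝ V = 2) {u w : V}
    (h : LinearIndependent ℝ ![u, w]) (y : V) : ∃ a b : ℝ, y = a • u + b • w := by
  have hs := h.span_eq_top_of_card_eq_finrank (by simp [hdim])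
  have hy : y ∈ Submodule.span ℝ (Set.range ![u, w]) := hs ▸ Submodule.mem_top
  rw [Matrix.range_cons, Matrix.range_cons, Matrix.range_empty, Set.union_empty,
    Set.singleton_union, Submodule.mem_span_pair] at hy
  obtain ⟨a, b, hab⟩ := hy
  exact ⟨a, b, hab.symm⟩

variable [StrictConvexSpace ℝ V] {r : ℝ} {u₁ u₂ u₃ c : V}

/-- If the center of a disk is a convex combination of three points of its boundary circle, then
no other disk whose radius is at most as large contains these points. -/
lemma eq_zero_of_norm_sub_le_three (hdim : Module.finrank ℝ V = 2) (hr : 0 < r)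
    (h₁ : ‖u₁‖ = r) (h₂ : ‖u₂‖ = r) (h₃ : ‖u₃‖ = r) {t₁ t₂ t₃ : ℝ} (ht₁ : 0 ≤ t₁) (ht₂ : 0 ≤ t₂)
    (ht₃ : 0 ≤ t₃) (ht : 0 < t₁ + t₂ + t₃) (hsum : t₁ • u₁ + t₂ • u₂ + t₃ • u₃ = 0)
    (hc₁ : ‖u₁ - c‖ ≤ r) (hc₂ : ‖u₂ - c‖ ≤ r) (hc₃ : ‖u₃ - c‖ ≤ r) : c = 0 := by
  have anti : ∀ {u w : V}, ‖u‖ = r → ‖u - c‖ ≤ r → ‖w - c‖ ≤ r → w = -u → c = 0 := by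
    rintro u w hu huc hwc rfl
    refine eq_zero_of_norm_sub_le_of_norm_add_le hu huc ?_
    rwa [← norm_neg, show -(u + c) = -u - c by abel]
  rcases eq_or_lt_of_le ht₁ with rfl | ht₁
  · exact anti h₂ hc₂ hc₃ (eq_neg_of_smul_add_smul_eq_zero hr h₂ h₃ ht₂ ht₃ (by linarith)
      (by simpa using hsum))
  rcases eq_or_lt_of_le ht₂ with rfl | ht₂
  · exact anti h₁ hc₁ hc₃ (eq_neg_of_smul_add_smul_eq_zero hr h₁ h₃ ht₁.le ht₃ (by linarith)
      (by simpa using hsum))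
  rcases eq_or_lt_of_le ht₃ with rfl | ht₃
  · exact anti h₁ hc₁ hc₂ (eq_neg_of_smul_add_smul_eq_zero hr h₁ h₂ ht₁.le ht₂.le (by linarith)
      (by simpa using hsum))
  by_cases he : u₁ = u₂
  · subst he
    exact anti h₁ hc₁ hc₃ (eq_neg_of_smul_add_smul_eq_zero hr h₁ h₃ (s := t₁ + t₂) (by positivity)
      ht₃.le (by linarith) (by rw [add_smul, hsum]))
  by_cases hn : u₂ = -u₁
  · exact anti h₁ hc₁ hc₂ hn
  obtain ⟨α, β, hαβ⟩ := exists_eq_smul_add_smul hdim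
    (linearIndependent_pair_of_norm_eq hr h₁ h₂ he hn) (-c)
  -- Subtracting the right multiple of the relation makes one of the three coefficients
  -- of `-c` vanish and keeps the other two nonnegative.
  have hm : ∀ m : ℝ, -c = (α - m * t₁) • u₁ + (β - m * t₂) • u₂ + (-m * t₃) • u₃ := by
    intro m
    have : -c = α • u₁ + β • u₂ - m • (t₁ • u₁ + t₂ • u₂ + t₃ • u₃) := by
      rw [hsum, smul_zero, sub_zero, hαβ]
    rw [this]; module
  by_cases hpos : 0 ≤ α ∧ 0 ≤ β
  · exact eq_zero_of_neg_mem_cone hr h₁ h₂ hc₁ hc₂ hpos.1 hpos.2 hαβ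
  rcases le_total (β * t₁) (α * t₂) with hle | hle
  · have hβ : β ≤ 0 := by
      by_contra hβ
      push Not at hβ
      refine hpos ⟨?_, hβ.le⟩
      by_contra hα
      push Not at hα
      nlinarith [mul_pos hβ ht₁]
    have h := hm (β / t₂)
    rw [div_mul_cancel₀ _ ht₂.ne', sub_self, zero_smul, add_zero] at h
    refine eq_zero_of_neg_mem_cone hr h₁ h₃ hc₁ hc₃ ?_ ?_ h
    · rw [sub_nonneg, div_mul_eq_mul_div, div_le_iff₀ ht₂]
      exact hle
    · exact mul_nonneg (neg_nonneg.2 (div_nonpos_of_nonpos_of_nonneg hβ ht₂.le)) ht₃.le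
  · have hα : α ≤ 0 := by
      by_contra hα
      push Not at hα
      refine hpos ⟨hα.le, ?_⟩
      by_contra hβ
      push Not at hβ
      nlinarith [mul_pos hα ht₂]
    have h := hm (α / t₁)
    rw [div_mul_cancel₀ _ ht₁.ne', sub_self, zero_smul, zero_add] at h
    refine eq_zero_of_neg_mem_cone hr h₂ h₃ hc₂ hc₃ ?_ ?_ h
    · rw [sub_nonneg, div_mul_eq_mul_div, div_le_iff₀ ht₁]
      exact hle
    · exact mul_nonneg (neg_nonneg.2 (div_nonpos_of_nonpos_of_nonneg hα ht₁.le)) ht₃.le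

/-- If the origin is a positive combination of three distinct vectors of equal length, then it is
the only point with equal distances to them. -/
lemma eq_zero_of_norm_sub_eq_three (hdim : Module.finrank ℝ V = 2)
    (hli : LinearIndependent ℝ ![u₁, u₂]) (h₁₃ : u₁ ≠ u₃) (h₂₃ : u₂ ≠ u₃)
    (h₁ : ‖u₁‖ = r) (h₂ : ‖u₂‖ = r) (h₃ : ‖u₃‖ = r) {t₁ t₂ t₃ : ℝ} (ht₁ : 0 < t₁) (ht₂ : 0 < t₂)
    (ht₃ : 0 < t₃) (hsum : t₁ • u₁ + t₂ • u₂ + t₃ • u₃ = 0)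
    (hc : ‖c - u₁‖ = ‖c - u₂‖) (hc' : ‖c - u₂‖ = ‖c - u₃‖) : c = 0 := by
  have h₁₂ : u₁ ≠ u₂ := by
    have := hli.injective.ne (show (0 : Fin 2) ≠ 1 by decide)
    simpa using this
  obtain ⟨α, β, hαβ⟩ := exists_eq_smul_add_smul hdim hli c
  -- Subtracting the right multiple of the relation makes one of the three coefficients
  -- of `c` vanish, and one of the others nonnegative, the last one nonpositive.
  have hm : ∀ m : ℝ, c = (α - m * t₁) • u₁ + (β - m * t₂) • u₂ + (-m * t₃) • u₃ := by
    intro m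
    have : c = α • u₁ + β • u₂ - m • (t₁ • u₁ + t₂ • u₂ + t₃ • u₃) := by
      rw [hsum, smul_zero, sub_zero, hαβ]
    rw [this]; module
  have key : ∀ {u w : V}, ‖u‖ = r → ‖w‖ = r → u ≠ w → ‖c - u‖ = ‖c - w‖ → ∀ {a b : ℝ},
      0 ≤ a → b ≤ 0 → c = a • u + b • w → c = 0 := by
    intro u w hu hw hne he a b ha hb hcc
    exact eq_zero_of_cone_of_norm_sub_eq hu hw hne ha (neg_nonneg.2 hb)
      (by rw [hcc]; module) he
  have e1 := hm (α / t₁)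
  rw [div_mul_cancel₀ _ ht₁.ne', sub_self, zero_smul, zero_add] at e1
  have e2 := hm (β / t₂)
  rw [div_mul_cancel₀ _ ht₂.ne', sub_self, zero_smul, add_zero] at e2
  have c1 : β * t₁ ≤ α * t₂ → β - α / t₁ * t₂ ≤ 0 := fun h => by
    rw [sub_nonpos, div_mul_eq_mul_div, le_div_iff₀ ht₁]; exact h
  have c1' : α * t₂ ≤ β * t₁ → 0 ≤ β - α / t₁ * t₂ := fun h => by
    rw [sub_nonneg, div_mul_eq_mul_div, div_le_iff₀ ht₁]; exact h
  have c2 : β * t₁ ≤ α * t₂ → 0 ≤ α - β / t₂ * t₁ := fun h => by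
    rw [sub_nonneg, div_mul_eq_mul_div, div_le_iff₀ ht₂]; exact h
  have c2' : α * t₂ ≤ β * t₁ → α - β / t₂ * t₁ ≤ 0 := fun h => by
    rw [sub_nonpos, div_mul_eq_mul_div, le_div_iff₀ ht₂]; exact h
  have d1 : 0 ≤ α → -(α / t₁) * t₃ ≤ 0 := fun h => by
    have := mul_nonneg (div_nonneg h ht₁.le) ht₃.le; linarith
  have d1' : α ≤ 0 → 0 ≤ -(α / t₁) * t₃ := fun h =>
    mul_nonneg (neg_nonneg.2 (div_nonpos_of_nonpos_of_nonneg h ht₁.le)) ht₃.le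
  have d2 : 0 ≤ β → -(β / t₂) * t₃ ≤ 0 := fun h => by
    have := mul_nonneg (div_nonneg h ht₂.le) ht₃.le; linarith
  have d2' : β ≤ 0 → 0 ≤ -(β / t₂) * t₃ := fun h =>
    mul_nonneg (neg_nonneg.2 (div_nonpos_of_nonpos_of_nonneg h ht₂.le)) ht₃.le
  rcases le_total 0 α with hα | hα <;> rcases le_total 0 β with hβ | hβ
  · rcases le_total (β * t₁) (α * t₂) with hle | hle
    · exact key h₁ h₃ h₁₃ (hc.trans hc') (c2 hle) (d2 hβ) e2
    · exact key h₂ h₃ h₂₃ hc' (c1' hle) (d1 hα) e1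
  · exact key h₁ h₂ h₁₂ hc hα hβ hαβ
  · exact key h₂ h₁ h₁₂.symm hc.symm hβ hα (by rw [hαβ, add_comm])
  · rcases le_total (β * t₁) (α * t₂) with hle | hle
    · exact key h₃ h₂ h₂₃.symm hc'.symm (d1' hα) (c1 hle) (by rw [add_comm]; exact e1)
    · exact key h₃ h₁ h₁₃.symm (hc.trans hc').symm (d2' hβ) (c2' hle)
        (by rw [add_comm]; exact e2)

end Plane

/-! ### Minimal enclosing disks -/

section MinDisk

variable {V : Type*} [NormedAddCommGroup V]

/-- The disk with center `x` and radius `r` encloses `S` with a point of `S` on its boundary, and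
no other disk with the same radius encloses `S`. -/
def IsMinDisk (S : Set V) (x : V) (r : ℝ) : Prop :=
  (∀ p ∈ S, ‖x - p‖ ≤ r) ∧ (∃ p ∈ S, ‖x - p‖ = r) ∧ ∀ c, c ≠ x → ∃ p ∈ S, r < ‖c - p‖

lemma IsMinDisk.radius_le {S T : Set V} {x y : V} {r s : ℝ} (h : IsMinDisk S x r)
    (hST : S ⊆ T) (hT : ∀ p ∈ T, ‖y - p‖ ≤ s) : r ≤ s := by
  by_cases hxy : y = x
  · subst hxy
    obtain ⟨p, hp, hpr⟩ := h.2.1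
    exact hpr ▸ hT p (hST hp)
  · obtain ⟨p, hp, hpr⟩ := h.2.2 y hxy
    exact hpr.le.trans (hT p (hST hp))

lemma IsMinDisk.radius_unique {S : Set V} {x y : V} {r s : ℝ} (h : IsMinDisk S x r)
    (h' : IsMinDisk S y s) : r = s :=
  le_antisymm (h.radius_le subset_rfl h'.1) (h'.radius_le subset_rfl h.1)

/-- Adding to `S` a point outside of its minimal enclosing disk makes every enclosing disk
strictly larger. -/
lemma IsMinDisk.exists_lt {S T : Set V} {x p : V} {r : ℝ} (h : IsMinDisk S x r)
    (hST : S ⊆ T) (hp : p ∈ T) (hout : r < ‖x - p‖) (c : V) : ∃ q ∈ T, r < ‖c - q‖ := by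
  by_cases hc : c = x
  · exact ⟨p, hp, hc ▸ hout⟩
  · obtain ⟨q, hq, hqr⟩ := h.2.2 c hc
    exact ⟨q, hST hq, hqr⟩

lemma IsMinDisk.mono {S T : Set V} {x : V} {r : ℝ} (h : IsMinDisk S x r) (hST : S ⊆ T)
    (hall : ∀ p ∈ T, ‖x - p‖ ≤ r) : IsMinDisk T x r := by
  refine ⟨hall, ?_, fun c hc => ?_⟩
  · obtain ⟨p, hp, hpr⟩ := h.2.1
    exact ⟨p, hST hp, hpr⟩
  · obtain ⟨p, hp, hpr⟩ := h.2.2 c hc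
    exact ⟨p, hST hp, hpr⟩

lemma norm_le_maxDist (P : Finset V) (x : V) {p : V} (hp : p ∈ P) : ‖x - p‖ ≤ maxDist P x :=
  le_ciSup (f := fun q : P => ‖x - (q : V)‖) (Set.finite_range _).bddAbove ⟨p, hp⟩

lemma IsMinDisk.maxDist_eq {P : Finset V} {x : V} {r : ℝ} (h : IsMinDisk (P : Set V) x r) :
    maxDist P x = r := by
  obtain ⟨hle, ⟨p, hp, hpr⟩, -⟩ := h
  have : Nonempty P := ⟨⟨p, hp⟩⟩
  exact le_antisymm (ciSup_le fun q => hle q q.2) (hpr ▸ norm_le_maxDist P x hp)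

lemma IsMinDisk.optRadius_eq {P : Finset V} {x : V} {r : ℝ} (h : IsMinDisk (P : Set V) x r) :
    optRadius P = r := by
  have hlow : ∀ y, r ≤ maxDist P y := fun y =>
    h.radius_le subset_rfl fun p hp => norm_le_maxDist P y hp
  refine le_antisymm ?_ (le_ciInf hlow)
  have := ciInf_le (f := maxDist P) ⟨r, by rintro _ ⟨y, rfl⟩; exact hlow y⟩ x
  rwa [h.maxDist_eq] at this

lemma IsMinDisk.optCenters_eq {P : Finset V} {x : V} {r : ℝ} (h : IsMinDisk (P : Set V) x r) :
    optCenters P = {x} := by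
  ext c
  simp only [optCenters, Set.mem_ofPred_eq, Set.mem_singleton_iff, h.optRadius_eq]
  refine ⟨fun hc => ?_, fun hc => hc ▸ h.maxDist_eq⟩
  by_contra hne
  obtain ⟨p, hp, hpr⟩ := h.2.2 c hne
  exact (hpr.trans_le (norm_le_maxDist P c hp)).ne hc.symm

lemma isMinDisk_pair [NormedSpace ℝ V] [StrictConvexSpace ℝ V] (p q : V) :
    IsMinDisk {p, q} ((1 / 2 : ℝ) • (p + q)) ((1 / 2 : ℝ) * ‖p - q‖) := by
  have n : ∀ v : V, ‖(1 / 2 : ℝ) • v‖ = 1 / 2 * ‖v‖ := fun v => by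
    rw [norm_smul, Real.norm_of_nonneg (by norm_num)]
  have e1 : ‖(1 / 2 : ℝ) • (p + q) - p‖ = 1 / 2 * ‖p - q‖ := by
    rw [← n, ← norm_neg]; congr 1; module
  have e2 : ‖(1 / 2 : ℝ) • (p + q) - q‖ = 1 / 2 * ‖p - q‖ := by
    rw [← n]; congr 1; module
  refine ⟨?_, ⟨p, by simp, e1⟩, fun c hc => ?_⟩
  · rintro x (rfl | rfl)
    exacts [e1.le, e2.le]
  · by_contra! hcon
    have h1 := hcon p (by simp)
    have h2 := hcon q (by simp)
    refine hc (sub_eq_zero.1 (eq_zero_of_norm_sub_le_of_norm_add_le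
      (u := (1 / 2 : ℝ) • (p - q)) (n _) ?_ ?_))
    · refine le_of_eq_of_le ?_ h1
      rw [← norm_neg]; congr 1; module
    · refine le_of_eq_of_le ?_ h2
      congr 1; module

end MinDisk

/-! ### Circumcenters of triangles that contain them in the interior -/

section Circumcenter

variable {V : Type*} [NormedAddCommGroup V] [NormedSpace ℝ V]

/-- The point `x` is equidistant from the three distinct points `p₁`, `p₂`, `p₃` and has positive
barycentric coordinates with respect to them. -/
structure IsInnerCircumcenter (x p₁ p₂ p₃ : V) : Prop where
  ne₁₂ : p₁ ≠ p₂
  ne₁₃ : p₁ ≠ p₃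
  ne₂₃ : p₂ ≠ p₃
  eq₁₂ : ‖x - p₁‖ = ‖x - p₂‖
  eq₂₃ : ‖x - p₂‖ = ‖x - p₃‖
  bary : ∃ t₁ t₂ t₃ : ℝ, 0 < t₁ ∧ 0 < t₂ ∧ 0 < t₃ ∧
    t₁ • (p₁ - x) + t₂ • (p₂ - x) + t₃ • (p₃ - x) = 0

namespace IsInnerCircumcenter

variable {x p₁ p₂ p₃ : V}

lemma rotate (h : IsInnerCircumcenter x p₁ p₂ p₃) : IsInnerCircumcenter x p₂ p₃ p₁ := by
  obtain ⟨t₁, t₂, t₃, h₁, h₂, h₃, hs⟩ := h.bary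
  exact ⟨h.ne₂₃, h.ne₁₂.symm, h.ne₁₃.symm, h.eq₂₃, (h.eq₁₂.trans h.eq₂₃).symm,
    t₂, t₃, t₁, h₂, h₃, h₁, by rw [← hs]; abel⟩

lemma swap (h : IsInnerCircumcenter x p₁ p₂ p₃) : IsInnerCircumcenter x p₁ p₃ p₂ := by
  obtain ⟨t₁, t₂, t₃, h₁, h₂, h₃, hs⟩ := h.bary
  exact ⟨h.ne₁₃, h.ne₁₂, h.ne₂₃.symm, h.eq₁₂.trans h.eq₂₃, h.eq₂₃.symm,
    t₁, t₃, t₂, h₁, h₃, h₂, by rw [← hs]; abel⟩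

lemma radius_pos (h : IsInnerCircumcenter x p₁ p₂ p₃) : 0 < ‖x - p₁‖ := by
  rw [norm_pos_iff, sub_ne_zero]
  rintro rfl
  have := h.eq₁₂
  rw [sub_self, norm_zero, eq_comm, norm_eq_zero, sub_eq_zero] at this
  exact h.ne₁₂ this

lemma linearIndependent (h : IsInnerCircumcenter x p₁ p₂ p₃) :
    LinearIndependent ℝ ![p₁ - x, p₂ - x] := by
  have n₁ : ‖p₁ - x‖ = ‖x - p₁‖ := norm_sub_rev _ _
  have n₂ : ‖p₂ - x‖ = ‖x - p₁‖ := by rw [norm_sub_rev, h.eq₁₂]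
  have n₃ : ‖p₃ - x‖ = ‖x - p₁‖ := by rw [norm_sub_rev, h.eq₁₂, h.eq₂₃]
  refine linearIndependent_pair_of_norm_eq h.radius_pos n₁ n₂
    (fun e => h.ne₁₂ (sub_left_injective e)) fun e => ?_
  -- If `p₂ - x = -(p₁ - x)`, then `p₃ - x` would be one of these two vectors.
  obtain ⟨t₁, t₂, t₃, h₁, h₂, h₃, hs⟩ := h.bary
  have hs' : (t₁ - t₂) • (p₁ - x) + t₃ • (p₃ - x) = 0 := by
    rw [← hs, e]; module
  rcases eq_or_eq_neg_of_smul_add_smul_eq_zero h.radius_pos n₁ n₃ (Or.inr h₃.ne') hs' with e' | e'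
  · exact h.ne₁₃ (sub_left_injective e')
  · exact h.ne₂₃ (sub_left_injective (e.trans e'.symm))

variable [StrictConvexSpace ℝ V]

lemma isMinDisk (hdim : Module.finrank ℝ V = 2) (h : IsInnerCircumcenter x p₁ p₂ p₃) :
    IsMinDisk {p₁, p₂, p₃} x ‖x - p₁‖ := by
  refine ⟨?_, ⟨p₁, by simp, rfl⟩, fun c hc => ?_⟩
  · rintro p (rfl | rfl | rfl)
    exacts [le_rfl, h.eq₁₂.ge, (h.eq₁₂.trans h.eq₂₃).ge]
  · by_contra! hcon
    obtain ⟨t₁, t₂, t₃, h₁, h₂, h₃, hs⟩ := h.bary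
    have e : ∀ p ∈ ({p₁, p₂, p₃} : Set V), ‖p - x - (c - x)‖ ≤ ‖x - p₁‖ := fun p hp => by
      rw [sub_sub_sub_cancel_right, norm_sub_rev]; exact hcon p hp
    exact hc (sub_eq_zero.1 (eq_zero_of_norm_sub_le_three hdim h.radius_pos (norm_sub_rev _ _)
      (by rw [norm_sub_rev, h.eq₁₂]) (by rw [norm_sub_rev, h.eq₁₂, h.eq₂₃]) h₁.le h₂.le h₃.le
      (by positivity) hs (e p₁ (by simp)) (e p₂ (by simp)) (e p₃ (by simp))))

lemma bisec_inter_bisec (hdim : Module.finrank ℝ V = 2) (h : IsInnerCircumcenter x p₁ p₂ p₃) :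
    bisec p₁ p₂ ∩ bisec p₂ p₃ = {x} := by
  refine Set.eq_singleton_iff_unique_mem.2 ⟨⟨h.eq₁₂, h.eq₂₃⟩, ?_⟩
  rintro y ⟨hy, hy'⟩
  obtain ⟨t₁, t₂, t₃, h₁, h₂, h₃, hs⟩ := h.bary
  refine sub_eq_zero.1 (eq_zero_of_norm_sub_eq_three hdim h.linearIndependent
    (fun e => h.ne₁₃ (sub_left_injective e)) (fun e => h.ne₂₃ (sub_left_injective e))
    (norm_sub_rev _ _) (by rw [norm_sub_rev, h.eq₁₂]) (by rw [norm_sub_rev, h.eq₁₂, h.eq₂₃])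
    h₁ h₂ h₃ hs ?_ ?_) <;> simpa only [sub_sub_sub_cancel_right]

end IsInnerCircumcenter

end Circumcenter

/-! ### The exchange step -/

section Exchange

variable {V : Type*} [NormedAddCommGroup V] [NormedSpace ℝ V] [StrictConvexSpace ℝ V]

/-- The exchange step enlarges the minimal enclosing disk. Here `p₆` lies on the line through `x`
and `p₅` or is separated by it from `p₄`. If `p₄ - x` had a positive coefficient at `p₅ - x`, then
`p₄` would be closer to `p₅` than to `p₆`; hence `x` is a convex combination of `p₄`, `p₅`, `p₆`. -/
lemma exists_lt_of_exchange (hdim : Module.finrank ℝ V = 2) {x p₄ p₅ p₆ : V} {r a b : ℝ}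
    (hr : 0 < r) (h₅ : ‖x - p₅‖ = r) (h₆ : ‖x - p₆‖ = r) (h₄ : r < ‖x - p₄‖) (hne : p₅ ≠ p₆)
    (hb : 0 ≤ b) (hab : p₄ - x = a • (p₅ - x) - b • (p₆ - x)) (hfar : ‖p₄ - p₆‖ ≤ ‖p₄ - p₅‖)
    (c : V) : ∃ p ∈ ({p₄, p₅, p₆} : Set V), r < ‖c - p‖ := by
  rw [norm_sub_rev] at h₄ h₅ h₆
  have ha : a ≤ 0 := by
    by_contra! ha
    have := norm_sub_lt_norm_sub_of_cone h₅ h₆ (fun e => hne (sub_left_injective e)) ha.le hb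
      (by linarith)
    rw [← hab, sub_sub_sub_cancel_right, sub_sub_sub_cancel_right] at this
    exact this.not_ge hfar
  by_contra! hcon
  have e : ∀ p ∈ ({p₄, p₅, p₆} : Set V), ‖p - x - (c - x)‖ ≤ r := fun p hp => by
    rw [sub_sub_sub_cancel_right, norm_sub_rev]; exact hcon p hp
  set v := p₄ - x
  set u := p₅ - x
  set w := p₆ - x
  set d := c - x
  have e4 : ‖v - d‖ ≤ r := e p₄ (by simp)
  have e5 : ‖u - d‖ ≤ r := e p₅ (by simp)
  have e6 : ‖w - d‖ ≤ r := e p₆ (by simp)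
  have hv : 0 < ‖v‖ := hr.trans h₄
  -- The disk around `d` contains the origin, hence the point of the segment from the origin to `v`
  -- at distance `r` from the origin.
  have hd : ‖d‖ ≤ r := by
    have e : (1 + -a + b) • d = -((v - d) + (-a) • (u - d) + b • (w - d)) := by
      rw [hab]; module
    have h := norm_add₃_le (a := v - d) (b := (-a) • (u - d)) (c := b • (w - d))
    rw [← norm_neg, ← e, norm_smul, norm_smul, norm_smul, Real.norm_of_nonneg (by linarith),
      Real.norm_of_nonneg (by linarith), Real.norm_of_nonneg hb] at h
    have h5 := mul_le_mul_of_nonneg_left e5 (neg_nonneg.2 ha)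
    have h6 := mul_le_mul_of_nonneg_left e6 hb
    refine le_of_mul_le_mul_left (a := 1 + -a + b) ?_ (by linarith)
    linarith
  have hv' : ‖(r / ‖v‖) • v - d‖ ≤ r := by
    have hk : r / ‖v‖ ≤ 1 := (div_le_one hv).2 h₄.le
    have hk0 : 0 ≤ r / ‖v‖ := (div_pos hr hv).le
    have e : (r / ‖v‖) • v - d = (r / ‖v‖) • (v - d) - (1 - r / ‖v‖) • d := by module
    have h := norm_sub_le ((r / ‖v‖) • (v - d)) ((1 - r / ‖v‖) • d)
    rw [← e, norm_smul, norm_smul, Real.norm_of_nonneg hk0,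
      Real.norm_of_nonneg (sub_nonneg.2 hk)] at h
    have h1 := mul_le_mul_of_nonneg_left e4 hk0
    have h2 := mul_le_mul_of_nonneg_left hd (sub_nonneg.2 hk)
    linarith
  have hn : ‖(r / ‖v‖) • v‖ = r := by
    rw [norm_smul, Real.norm_of_nonneg (div_pos hr hv).le, div_mul_cancel₀ _ hv.ne']
  have hd0 : d = 0 := by
    refine eq_zero_of_norm_sub_le_three hdim hr hn h₅ h₆ (t₁ := ‖v‖ / r) (t₂ := -a) (t₃ := b)
      (div_pos hv hr).le (neg_nonneg.2 ha) hb ?_ ?_ hv' e5 e6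
    · have := div_pos hv hr
      linarith
    · rw [smul_smul, div_mul_div_cancel₀ hr.ne', div_self hv.ne', hab]
      module
  rw [hd0, sub_zero] at e4
  exact e4.not_gt h₄

end Exchange

/-! ### Norm-acute triangles and their circumcenters -/

section Triangle

variable {V : Type*}

/-- In a set of three distinct points, the two points other than a given one are determined up to
their order. -/
lemma exists_other_pair_iff {v c d : V} (hc : v ≠ c) (hd : v ≠ d) (hcd : c ≠ d)
    {Q : V → V → Prop} (hQ : ∀ a b, Q a b → Q b a) :
    (∃ a b : V, v ≠ a ∧ v ≠ b ∧ a ≠ b ∧ ({v, c, d} : Set V) = {v, a, b} ∧ Q a b) ↔ Q c d := by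
  refine ⟨?_, fun h => ⟨c, d, hc, hd, hcd, rfl, h⟩⟩
  rintro ⟨a, b, ha, hb, hab, hT, h⟩
  have hset : ({c, d} : Set V) = {a, b} := by
    have e : ∀ {s t : V}, v ≠ s → v ≠ t → ({v, s, t} : Set V) \ {v} = {s, t} := by
      intro s t hs ht
      rw [Set.insert_sdiff_of_mem _ (Set.mem_singleton v), Set.sdiff_singleton_eq_self]
      simp [hs, ht]
    rw [← e hc hd, ← e ha hb, hT]
  rcases Set.pair_eq_pair_iff.1 hset with ⟨rfl, rfl⟩ | ⟨rfl, rfl⟩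
  exacts [h, hQ _ _ h]

variable [NormedAddCommGroup V] [NormedSpace ℝ V] {p₁ p₂ p₃ : V}

lemma normAcuteAt_iff {v a b : V} (ha : v ≠ a) (hb : v ≠ b) (hab : a ≠ b) :
    NormAcuteAt {v, a, b} v ↔ ‖v - (1 / 2 : ℝ) • (a + b)‖ > ‖a - b‖ / 2 :=
  exists_other_pair_iff ha hb hab fun c d h => by rwa [add_comm, norm_sub_rev d]

/-- At most one vertex of a triangle fails to be norm-acute. -/
lemma eq_of_norm_sub_midpoint_le [StrictConvexSpace ℝ V] {v a b : V}
    (hv : ‖v - (1 / 2 : ℝ) • (a + b)‖ ≤ ‖a - b‖ / 2)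
    (ha : ‖a - (1 / 2 : ℝ) • (v + b)‖ ≤ ‖v - b‖ / 2) : v = a := by
  have n : ∀ y : V, ‖(2 : ℝ) • y‖ = 2 * ‖y‖ := fun y => by
    rw [norm_smul, Real.norm_of_nonneg (by norm_num)]
  have hv' : ‖(2 : ℝ) • (v - b) - (a - b)‖ ≤ ‖a - b‖ := by
    rw [show (2 : ℝ) • (v - b) - (a - b) = (2 : ℝ) • (v - (1 / 2 : ℝ) • (a + b)) by module, n]
    linarith
  have ha' : ‖(2 : ℝ) • (a - b) - (v - b)‖ ≤ ‖v - b‖ := by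
    rw [show (2 : ℝ) • (a - b) - (v - b) = (2 : ℝ) • (a - (1 / 2 : ℝ) • (v + b)) by module, n]
    linarith
  have h1 : ‖v - b‖ ≤ ‖a - b‖ := by
    have := norm_add_le ((2 : ℝ) • (v - b) - (a - b)) (a - b)
    rw [sub_add_cancel, n] at this
    linarith
  have h2 : ‖a - b‖ ≤ ‖v - b‖ := by
    have := norm_add_le ((2 : ℝ) • (a - b) - (v - b)) (v - b)
    rw [sub_add_cancel, n] at this
    linarith
  by_contra hne
  have h := norm_combo_lt_of_ne ha' le_rfl
    (fun e => hne (by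
      have e' : (2 : ℝ) • (a - v) = 0 := by
        calc (2 : ℝ) • (a - v) = ((2 : ℝ) • (a - b) - (v - b)) - (v - b) := by module
          _ = 0 := by rw [e, sub_self]
      exact (sub_eq_zero.1 ((smul_eq_zero_iff_right two_ne_zero).1 e')).symm))
    (half_pos one_pos) (half_pos one_pos) (add_halves (1 : ℝ))
  rw [show (1 / 2 : ℝ) • ((2 : ℝ) • (a - b) - (v - b)) + (1 / 2 : ℝ) • (v - b) = a - b by
    module] at h
  exact h.not_ge h1

lemma normObtuseWith_or_normRightWith [StrictConvexSpace ℝ V] {v a b : V} (ha : v ≠ a)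
    (hb : v ≠ b) (hab : a ≠ b) (h : ¬ NormAcuteAt {v, a, b} v) :
    NormObtuseWith {v, a, b} v ∨ NormRightWith {v, a, b} v := by
  rw [normAcuteAt_iff ha hb hab, not_lt] at h
  have hother : ∀ w ∈ ({v, a, b} : Set V), w ≠ v → NormAcuteAt {v, a, b} w := by
    rintro w (rfl | rfl | rfl) hw
    · exact absurd rfl hw
    · rw [Set.insert_comm, normAcuteAt_iff ha.symm hab hb]
      exact lt_of_not_ge fun h' => ha (eq_of_norm_sub_midpoint_le h h')
    · rw [Set.pair_comm, Set.insert_comm, normAcuteAt_iff hb.symm hab.symm ha]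
      rw [add_comm, norm_sub_rev a] at h
      exact lt_of_not_ge fun h' => hb (eq_of_norm_sub_midpoint_le h h')
  rcases h.lt_or_eq with h | h
  · exact Or.inl ⟨⟨a, b, ha, hb, hab, rfl, h⟩, hother⟩
  · exact Or.inr ⟨⟨a, b, ha, hb, hab, rfl, h⟩, hother⟩

/-- A triangle is norm-acute, norm-right or norm-obtuse. -/
lemma normAcute_of_not_exists [StrictConvexSpace ℝ V] (h₁₂ : p₁ ≠ p₂) (h₁₃ : p₁ ≠ p₃)
    (h₂₃ : p₂ ≠ p₃)
    (h : ¬ ∃ v, NormObtuseWith {p₁, p₂, p₃} v ∨ NormRightWith {p₁, p₂, p₃} v) :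
    NormAcute {p₁, p₂, p₃} := by
  refine ⟨Set.ncard_eq_three.2 ⟨p₁, p₂, p₃, h₁₂, h₁₃, h₂₃, rfl⟩, ?_⟩
  rintro v (rfl | rfl | rfl) <;> by_contra hv <;> refine h ⟨v, ?_⟩
  · exact normObtuseWith_or_normRightWith h₁₂ h₁₃ h₂₃ hv
  · rw [Set.insert_comm] at hv ⊢
    exact normObtuseWith_or_normRightWith h₁₂.symm h₂₃ h₁₃ hv
  · rw [Set.pair_comm, Set.insert_comm] at hv ⊢
    exact normObtuseWith_or_normRightWith h₁₃.symm h₂₃.symm h₁₂ hv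

lemma exists_eq_triple_of_with {T : Set V} {v : V} (h : NormObtuseWith T v ∨ NormRightWith T v) :
    ∃ a b, v ≠ a ∧ v ≠ b ∧ a ≠ b ∧ T = {v, a, b} ∧
      ‖v - (1 / 2 : ℝ) • (a + b)‖ ≤ ‖a - b‖ / 2 := by
  rcases h with ⟨⟨a, b, ha, hb, hab, hT, h⟩, -⟩ | ⟨⟨a, b, ha, hb, hab, hT, h⟩, -⟩
  exacts [⟨a, b, ha, hb, hab, hT, h.le⟩, ⟨a, b, ha, hb, hab, hT, h.le⟩]

lemma exists_minimizer_three [FiniteDimensional ℝ V] (p₁ p₂ p₃ : V) : ∃ (x : V) (R : ℝ),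
    ‖x - p₁‖ ≤ R ∧ ‖x - p₂‖ ≤ R ∧ ‖x - p₃‖ ≤ R ∧
    ¬ ∃ y, ‖y - p₁‖ < R ∧ ‖y - p₂‖ < R ∧ ‖y - p₃‖ < R := by
  have : ProperSpace V := FiniteDimensional.proper ℝ V
  let f : V → ℝ := fun y => max ‖y - p₁‖ (max ‖y - p₂‖ ‖y - p₃‖)
  have hf : Continuous f := by fun_prop
  have hlim : Filter.Tendsto f (Filter.cocompact V) Filter.atTop := by
    refine Filter.tendsto_atTop_mono (f := fun y => ‖y‖ - ‖p₁‖)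
      (fun y => (norm_sub_norm_le y p₁).trans (le_max_left _ _)) ?_
    exact Filter.tendsto_atTop_add_const_right _ _ tendsto_norm_cocompact_atTop
  obtain ⟨x, hx⟩ := hf.exists_forall_le hlim
  refine ⟨x, f x, le_max_left _ _, (le_max_left _ _).trans (le_max_right _ _),
    (le_max_right _ _).trans (le_max_right _ _), ?_⟩
  rintro ⟨y, h1, h2, h3⟩
  exact (hx y).not_gt (max_lt h1 (max_lt h2 h3))

variable [StrictConvexSpace ℝ V]

/-- A disk that contains `a`, `b` and, in its interior, `v` can be shrunk if the triangle is
norm-acute at `v`: move the center towards the midpoint of `a` and `b`. If the center is this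
midpoint already, then `a` and `b` are closer to it than `v` and lie in the interior, too. -/
lemma exists_norm_sub_lt_of_interior {x v a b : V} {R : ℝ} (ha : ‖x - a‖ ≤ R) (hb : ‖x - b‖ ≤ R)
    (hv : ‖x - v‖ < R) (hacute : ‖v - (1 / 2 : ℝ) • (a + b)‖ > ‖a - b‖ / 2) :
    ∃ y, ‖y - a‖ < R ∧ ‖y - b‖ < R ∧ ‖y - v‖ < R := by
  set m := (1 / 2 : ℝ) • (a + b) with hm
  have n : ∀ z : V, ‖(1 / 2 : ℝ) • z‖ = ‖z‖ / 2 := fun z => by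
    rw [norm_smul, Real.norm_of_nonneg (by norm_num)]; ring
  by_cases hx : x = m
  · have e1 : ‖x - a‖ = ‖a - b‖ / 2 := by
      rw [hx, hm, ← n, ← norm_neg]; congr 1; module
    have e2 : ‖x - b‖ = ‖a - b‖ / 2 := by
      rw [hx, hm, ← n]; congr 1; module
    rw [norm_sub_rev, ← hx] at hacute
    exact ⟨x, by linarith, by linarith, hv⟩
  have hδ : 0 < R - ‖x - v‖ := sub_pos.2 hv
  have hK : 0 ≤ ‖m - x‖ := norm_nonneg _
  obtain ⟨ε, hε, hε1, hεK⟩ : ∃ ε : ℝ, 0 < ε ∧ ε < 1 ∧ ε * ‖m - x‖ < R - ‖x - v‖ := by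
    have hD : 0 < ‖m - x‖ + (R - ‖x - v‖) + 1 := by linarith
    refine ⟨(R - ‖x - v‖) / (‖m - x‖ + (R - ‖x - v‖) + 1), div_pos hδ hD, ?_, ?_⟩
    · rw [div_lt_one hD]; linarith
    · rw [div_mul_eq_mul_div, div_lt_iff₀ hD]; nlinarith
  have hne : x - a ≠ -(x - b) := fun e => hx (by
    have e' : x = (1 / 2 : ℝ) • ((x - a) + (x - b)) + m := by rw [hm]; module
    rw [e', e]; simp)
  have hne' : x - b ≠ -(x - a) := fun e => hne (by rw [e, neg_neg])
  refine ⟨x + ε • (m - x), ?_, ?_, ?_⟩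
  · have := norm_combo_lt_of_ne ha ((norm_neg (x - b)).trans_le hb) hne (a := 1 - ε / 2)
      (b := ε / 2) (by linarith) (by linarith) (by ring)
    rwa [show x + ε • (m - x) - a = (1 - ε / 2) • (x - a) + (ε / 2) • -(x - b) by
      rw [hm]; module]
  · have := norm_combo_lt_of_ne hb ((norm_neg (x - a)).trans_le ha) hne' (a := 1 - ε / 2)
      (b := ε / 2) (by linarith) (by linarith) (by ring)
    rwa [show x + ε • (m - x) - b = (1 - ε / 2) • (x - b) + (ε / 2) • -(x - a) by
      rw [hm]; module]
  · have := norm_add_le (x - v) (ε • (m - x))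
    rw [norm_smul, Real.norm_of_nonneg hε.le] at this
    rw [show x + ε • (m - x) - v = x - v + ε • (m - x) by abel]
    linarith

/-- A disk with three boundary points, one of which lies in the cone spanned from the center by the
two others, can be shrunk. -/
lemma exists_norm_sub_lt_of_cone {x v a b : V} {R α β : ℝ} (ha : ‖a - x‖ = R) (hb : ‖b - x‖ = R)
    (hv : ‖v - x‖ = R) (hne : (a - x) + (b - x) ≠ 0) (hα : 0 < α) (hβ : 0 < β)
    (h : v - x = α • (a - x) + β • (b - x)) :
    ∃ y, ‖y - a‖ < R ∧ ‖y - b‖ < R ∧ ‖y - v‖ < R := by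
  obtain ⟨ε, hε, hε1, hεα, hεβ⟩ : ∃ ε : ℝ, 0 < ε ∧ ε < 1 ∧ ε ≤ α ∧ ε ≤ β :=
    ⟨min (1 / 2) (min α β), by positivity, (min_le_left _ _).trans_lt (by norm_num),
      (min_le_right _ _).trans (min_le_left _ _), (min_le_right _ _).trans (min_le_right _ _)⟩
  have hne₁ : a - x ≠ -(b - x) := fun e => hne (by rw [e]; simp)
  have hne₂ : b - x ≠ -(a - x) := fun e => hne (by rw [e]; simp)
  refine ⟨x + ε • ((a - x) + (b - x)), ?_, ?_, ?_⟩
  · have := norm_combo_lt_of_ne ha.le ((norm_neg (b - x)).trans_le hb.le) hne₁ (a := 1 - ε)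
      (b := ε) (by linarith) hε (by ring)
    rw [norm_sub_rev]
    refine lt_of_eq_of_lt (congrArg norm ?_) this
    module
  · have := norm_combo_lt_of_ne hb.le ((norm_neg (a - x)).trans_le ha.le) hne₂ (a := 1 - ε)
      (b := ε) (by linarith) hε (by ring)
    rw [norm_sub_rev]
    refine lt_of_eq_of_lt (congrArg norm ?_) this
    module
  · have := norm_lt_norm_translate ha hb hne (p := α - ε) (q := β - ε) (sub_nonneg.2 hεα)
      (sub_nonneg.2 hεβ) hε
    rw [sub_add_cancel, sub_add_cancel, ← h, hv] at this
    rw [norm_sub_rev]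
    refine lt_of_eq_of_lt (congrArg norm ?_) this
    rw [show v - (x + ε • ((a - x) + (b - x))) = (v - x) - ε • ((a - x) + (b - x)) by abel, h]
    module

/-- A norm-acute triangle has a circumcenter in its interior, namely the center of a minimal
enclosing disk: otherwise this disk could be shrunk by `exists_norm_sub_lt_of_interior` or
`exists_norm_sub_lt_of_cone`. -/
lemma NormAcute.exists_isInnerCircumcenter (hdim : Module.finrank ℝ V = 2) (h₁₂ : p₁ ≠ p₂)
    (h₁₃ : p₁ ≠ p₃) (h₂₃ : p₂ ≠ p₃) (h : NormAcute ({p₁, p₂, p₃} : Set V)) :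
    ∃ x, IsInnerCircumcenter x p₁ p₂ p₃ := by
  have : FiniteDimensional ℝ V := Module.finite_of_finrank_pos (by omega)
  have a₁ := h.2 p₁ (by simp)
  have a₂ := h.2 p₂ (by simp)
  have a₃ := h.2 p₃ (by simp)
  rw [normAcuteAt_iff h₁₂ h₁₃ h₂₃] at a₁
  rw [Set.insert_comm, normAcuteAt_iff h₁₂.symm h₂₃ h₁₃] at a₂
  rw [Set.pair_comm, Set.insert_comm, normAcuteAt_iff h₁₃.symm h₂₃.symm h₁₂] at a₃
  obtain ⟨x, R, l₁, l₂, l₃, hmin⟩ := exists_minimizer_three p₁ p₂ p₃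
  have e₁ : ‖x - p₁‖ = R := l₁.eq_of_not_lt fun hlt => hmin <| by
    obtain ⟨y, y2, y3, y1⟩ := exists_norm_sub_lt_of_interior l₂ l₃ hlt a₁
    exact ⟨y, y1, y2, y3⟩
  have e₂ : ‖x - p₂‖ = R := l₂.eq_of_not_lt fun hlt => hmin <| by
    obtain ⟨y, y1, y3, y2⟩ := exists_norm_sub_lt_of_interior l₁ l₃ hlt a₂
    exact ⟨y, y1, y2, y3⟩
  have e₃ : ‖x - p₃‖ = R := l₃.eq_of_not_lt fun hlt => hmin <|
    exists_norm_sub_lt_of_interior l₁ l₂ hlt a₃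
  have n₁ : ‖p₁ - x‖ = R := (norm_sub_rev _ _).trans e₁
  have n₂ : ‖p₂ - x‖ = R := (norm_sub_rev _ _).trans e₂
  have n₃ : ‖p₃ - x‖ = R := (norm_sub_rev _ _).trans e₃
  have hR : 0 < R := by
    rw [← n₁, norm_pos_iff, sub_ne_zero]
    rintro rfl
    rw [← n₁, sub_self, norm_zero, norm_eq_zero, sub_eq_zero] at e₂
    exact h₁₂ e₂
  -- No two vertices are antipodal, because the triangle is not norm-right at the third.
  have anti : ∀ {a b v : V}, ‖a - x‖ = R → ‖x - v‖ = R →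
      ‖v - (1 / 2 : ℝ) • (a + b)‖ > ‖a - b‖ / 2 → b - x ≠ -(a - x) := by
    intro a b v ha hv hacute e
    have hm : (1 / 2 : ℝ) • (a + b) = x := by
      rw [show (1 / 2 : ℝ) • (a + b) = (1 / 2 : ℝ) • ((a - x) + (b - x)) + x by module, e]
      simp
    have hab : a - b = (2 : ℝ) • (a - x) := by
      rw [show a - b = (a - x) - (b - x) by abel, e]; module
    rw [hm, hab, norm_smul, Real.norm_of_nonneg (by norm_num), ha, norm_sub_rev, hv] at hacute
    linarith
  have i₁₂ := anti n₁ e₃ a₃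
  have i₁₃ := anti n₁ e₂ a₂
  have i₂₃ := anti n₂ e₁ a₁
  have s : ∀ {a b : V}, b - x ≠ -(a - x) → (a - x) + (b - x) ≠ 0 := fun h' e =>
    h' (neg_eq_of_add_eq_zero_right e).symm
  obtain ⟨α, β, hαβ⟩ := exists_eq_smul_add_smul hdim
    (linearIndependent_pair_of_norm_eq hR n₁ n₂ (fun e => h₁₂ (sub_left_injective e)) i₁₂)
    (p₃ - x)
  have hα : α ≠ 0 := by
    rintro rfl
    rcases eq_or_eq_neg_of_smul_add_smul_eq_zero hR n₂ n₃ (s := β) (t := -1)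
      (Or.inr (by norm_num)) (by rw [hαβ]; module) with e | e
    exacts [h₂₃ (sub_left_injective e), i₂₃ e]
  have hβ : β ≠ 0 := by
    rintro rfl
    rcases eq_or_eq_neg_of_smul_add_smul_eq_zero hR n₁ n₃ (s := α) (t := -1)
      (Or.inr (by norm_num)) (by rw [hαβ]; module) with e | e
    exacts [h₁₃ (sub_left_injective e), i₁₃ e]
  rcases hα.lt_or_gt with hα | hα <;> rcases hβ.lt_or_gt with hβ | hβ
  · exact ⟨x, h₁₂, h₁₃, h₂₃, e₁.trans e₂.symm, e₂.trans e₃.symm, -α, -β, 1, by linarith,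
      by linarith, one_pos, by rw [hαβ]; module⟩
  · have e : p₂ - x = (-α / β) • (p₁ - x) + (1 / β) • (p₃ - x) := by
      rw [hαβ]
      match_scalars <;> field_simp <;> ring
    obtain ⟨y, y1, y3, y2⟩ := exists_norm_sub_lt_of_cone n₁ n₃ n₂ (s i₁₃)
      (div_pos (neg_pos.2 hα) hβ) (one_div_pos.2 hβ) e
    exact absurd ⟨y, y1, y2, y3⟩ hmin
  · have e : p₁ - x = (-β / α) • (p₂ - x) + (1 / α) • (p₃ - x) := by
      rw [hαβ]
      match_scalars <;> field_simp <;> ring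
    obtain ⟨y, y2, y3, y1⟩ := exists_norm_sub_lt_of_cone n₂ n₃ n₁ (s i₂₃)
      (div_pos (neg_pos.2 hβ) hα) (one_div_pos.2 hα) e
    exact absurd ⟨y, y1, y2, y3⟩ hmin
  · exact absurd (exists_norm_sub_lt_of_cone n₁ n₂ n₃ (s i₁₂) hα hβ hαβ) hmin

end Triangle

/-! ### Sides of the line through the center and a vertex -/

section Side

variable {V : Type*} [NormedAddCommGroup V] [NormedSpace ℝ V]

lemma mem_line_iff {x p y : V} : y ∈ line[ℝ, p, x] ↔ ∃ k : ℝ, y - x = k • (p - x) := by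
  rw [Set.pair_comm, mem_affineSpan_pair_iff_exists_lineMap_eq]
  refine exists_congr fun k => ?_
  rw [AffineMap.lineMap_apply, vsub_eq_sub, vadd_eq_add, ← eq_sub_iff_add_eq, eq_comm]

lemma mem_line_iff_coeff_eq_zero {x p q y : V} {α β : ℝ}
    (h : LinearIndependent ℝ ![p - x, q - x]) (hy : y - x = α • (p - x) + β • (q - x)) :
    y ∈ line[ℝ, p, x] ↔ β = 0 := by
  rw [mem_line_iff]
  constructor
  · rintro ⟨k, hk⟩
    exact (LinearIndependent.pair_iff.1 h (α - k) β
      (by rw [sub_smul, ← hk, hy]; abel)).2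
  · rintro rfl
    exact ⟨α, by rw [hy, zero_smul, add_zero]⟩

lemma sOppSide_line_iff {x p q y : V} {α β : ℝ} (h : LinearIndependent ℝ ![p - x, q - x])
    (hβ : β ≠ 0) (hy : y - x = α • (p - x) + β • (q - x)) :
    (line[ℝ, p, x]).SOppSide y q ↔ β < 0 := by
  have hyL : y ∉ line[ℝ, p, x] := fun hm => hβ ((mem_line_iff_coeff_eq_zero h hy).1 hm)
  have hqL : q ∉ line[ℝ, p, x] := fun hm => one_ne_zero ((mem_line_iff_coeff_eq_zero h
    (show q - x = (0 : ℝ) • (p - x) + (1 : ℝ) • (q - x) by module)).1 hm)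
  have hxL : x ∈ line[ℝ, p, x] := right_mem_affineSpan_pair ℝ p x
  rw [AffineSubspace.sOppSide_iff_exists_left hxL]
  constructor
  · rintro ⟨-, -, z, hz, hray⟩
    obtain ⟨k, hk⟩ := mem_line_iff.1 hz
    obtain ⟨s, t, hs, ht, hst⟩ := hray.exists_pos (vsub_ne_zero.2 fun e => hyL (e ▸ hxL))
      (vsub_ne_zero.2 fun e => hqL (e ▸ hz))
    rw [vsub_eq_sub, vsub_eq_sub, show z - q = (z - x) - (q - x) by abel, hk, hy] at hst
    have h0 := (LinearIndependent.pair_iff.1 h (s * α - t * k) (s * β + t)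
      (by rw [← sub_eq_zero] at hst; rw [← hst]; module)).2
    by_contra! hβ'
    nlinarith [mul_nonneg hs.le hβ']
  · intro hβ'
    refine ⟨hyL, hqL, x + (-α / β) • (p - x), mem_line_iff.2 ⟨-α / β, by abel⟩, ?_⟩
    have e : y -ᵥ x = (-β) • (x + (-α / β) • (p - x) -ᵥ q) := by
      rw [vsub_eq_sub, vsub_eq_sub, hy]
      match_scalars
      · field_simp
      · field_simp
        ring
      · ring
    rw [e]
    exact SameRay.sameRay_nonneg_smul_left _ (by linarith)

namespace IsInnerCircumcenter

variable {x p₁ p₂ p₃ : V}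

lemma exists_of_mem (h : IsInnerCircumcenter x p₁ p₂ p₃) {a : V}
    (ha : a ∈ ({p₁, p₂, p₃} : Set V)) :
    ∃ b c, IsInnerCircumcenter x a b c ∧ ({p₁, p₂, p₃} : Set V) = {a, b, c} := by
  rcases ha with rfl | rfl | rfl
  · exact ⟨_, _, h, rfl⟩
  · exact ⟨_, _, h.rotate, by rw [Set.insert_comm, Set.pair_comm p₁]⟩
  · exact ⟨_, _, h.rotate.rotate, by rw [Set.pair_comm, Set.insert_comm]⟩

lemma exists_of_mem_of_mem (h : IsInnerCircumcenter x p₁ p₂ p₃) {a b : V}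
    (ha : a ∈ ({p₁, p₂, p₃} : Set V)) (hb : b ∈ ({p₁, p₂, p₃} : Set V)) (hba : b ≠ a) :
    ∃ c, IsInnerCircumcenter x a b c := by
  obtain ⟨b', c', h', hT⟩ := h.exists_of_mem ha
  rw [hT] at hb
  rcases hb with rfl | rfl | rfl
  exacts [absurd rfl hba, ⟨_, h'⟩, ⟨_, h'.swap⟩]

/-- The line through the center and the vertex `p₁` separates `p₂` from `p₃`: when the basis vector
`p₂ - x` is replaced by `p₃ - x`, the coefficient changes its sign. -/
lemma exists_coeff (h : IsInnerCircumcenter x p₁ p₂ p₃) {y : V} {α β : ℝ}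
    (hy : y - x = α • (p₁ - x) + β • (p₂ - x)) :
    ∃ α' k : ℝ, 0 < k ∧ y - x = α' • (p₁ - x) + (-(k * β)) • (p₃ - x) := by
  obtain ⟨t₁, t₂, t₃, h₁, h₂, h₃, hs⟩ := h.bary
  refine ⟨α - β / t₂ * t₁, t₃ / t₂, div_pos h₃ h₂, ?_⟩
  have e : y - x = α • (p₁ - x) + β • (p₂ - x)
      - (β / t₂) • (t₁ • (p₁ - x) + t₂ • (p₂ - x) + t₃ • (p₃ - x)) := by
    rw [hs, smul_zero, sub_zero, hy]
  rw [e]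
  have e2 : β / t₂ * t₂ = β := div_mul_cancel₀ _ h₂.ne'
  have e3 : α • (p₁ - x) + β • (p₂ - x)
      - (β / t₂) • (t₁ • (p₁ - x) + t₂ • (p₂ - x) + t₃ • (p₃ - x))
      = (α - β / t₂ * t₁) • (p₁ - x) + (β - β / t₂ * t₂) • (p₂ - x)
        + (-(β / t₂ * t₃)) • (p₃ - x) := by module
  rw [e3, e2, sub_self, zero_smul, add_zero, div_mul_comm β t₂ t₃]

lemma sep_sOppSide_eq (h : IsInnerCircumcenter x p₁ p₂ p₃) {y : V} {α β : ℝ} (hβ : β < 0)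
    (hy : y - x = α • (p₁ - x) + β • (p₂ - x)) :
    {p ∈ ({p₁, p₂, p₃} : Set V) \ {p₁} | (line[ℝ, p₁, x]).SOppSide y p} = {p₂} := by
  refine Set.eq_singleton_iff_unique_mem.2
    ⟨⟨⟨by simp, h.ne₁₂.symm⟩, (sOppSide_line_iff h.linearIndependent hβ.ne hy).2 hβ⟩, ?_⟩
  rintro p ⟨⟨rfl | rfl | rfl, hp⟩, hside⟩
  · exact absurd rfl hp
  · rfl
  · obtain ⟨α', k, hk, hy'⟩ := h.exists_coeff hy
    have hpos : 0 < -(k * β) := by nlinarith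
    exact absurd ((sOppSide_line_iff h.swap.linearIndependent hpos.ne' hy').1 hside) hpos.not_gt

/-- The point `p₆` of the exchange step exists and is unique. -/
lemma exists_sep_sOppSide_eq (hdim : Module.finrank ℝ V = 2)
    (h : IsInnerCircumcenter x p₁ p₂ p₃) {y : V} (hy : y ∉ line[ℝ, p₁, x]) :
    ∃ q, {p ∈ ({p₁, p₂, p₃} : Set V) \ {p₁} | (line[ℝ, p₁, x]).SOppSide y p} = {q} := by
  obtain ⟨α, β, hαβ⟩ := exists_eq_smul_add_smul hdim h.linearIndependent (y - x)
  have hβ : β ≠ 0 := fun e => hy ((mem_line_iff_coeff_eq_zero h.linearIndependent hαβ).2 e)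
  rcases hβ.lt_or_gt with hβ | hβ
  · exact ⟨p₂, h.sep_sOppSide_eq hβ hαβ⟩
  · obtain ⟨α', k, hk, hy'⟩ := h.exists_coeff hαβ
    refine ⟨p₃, ?_⟩
    rw [Set.pair_comm]
    exact h.swap.sep_sOppSide_eq (neg_neg_of_pos (mul_pos hk hβ)) hy'

end IsInnerCircumcenter

end Side

/-! ### Runs of the algorithm -/

section Runs

variable {V : Type*}

lemma ne_of_insert_eq_insert {q₁ q₂ q₃ p₁ p₂ p₃ : V}
    (hq : ({q₁, q₂, q₃} : Set V) = {p₁, p₂, p₃}) (h₁₂ : p₁ ≠ p₂) (h₁₃ : p₁ ≠ p₃) (h₂₃ : p₂ ≠ p₃) :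
    q₁ ≠ q₂ ∧ q₁ ≠ q₃ ∧ q₂ ≠ q₃ := by
  have h3 : ({q₁, q₂, q₃} : Set V).ncard = 3 :=
    Set.ncard_eq_three.2 ⟨p₁, p₂, p₃, h₁₂, h₁₃, h₂₃, hq⟩
  have h2 : ∀ a b : V, ({a, b} : Set V).ncard ≠ 3 := fun a b h => by
    have := Set.ncard_insert_le a ({b} : Set V)
    rw [Set.ncard_singleton, h] at this
    omega
  refine ⟨?_, ?_, ?_⟩ <;> rintro rfl
  · exact h2 _ _ (by rwa [Set.insert_idem] at h3)
  · exact h2 _ _ (by rwa [Set.pair_comm q₂, Set.insert_idem] at h3)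
  · exact h2 q₁ q₂ (by rwa [Set.pair_eq_singleton] at h3)

variable [NormedAddCommGroup V]

/-- The points of the state force the radius of the present or next candidate disk to be larger
than `ρ`. Before the first line there are no such points; after the return, there is no further
candidate disk. -/
def RadiusExceeds (ρ : ℝ) : State V → Prop
  | .start => False
  | .pair p₁ p₂ => ρ < (1 / 2 : ℝ) * ‖p₁ - p₂‖
  | .pairDisk _ _ _ r => ρ < r
  | .tri p₁ p₂ p₃ => ∀ c, ∃ p ∈ ({p₁, p₂, p₃} : Set V), ρ < ‖c - p‖
  | .triDisk _ _ _ _ r => ρ < r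
  | .returned _ _ => True

lemma RadiusExceeds.mono {ρ σ : ℝ} (h : ρ ≤ σ) {s : State V} (hs : RadiusExceeds σ s) :
    RadiusExceeds ρ s := by
  cases s with
  | start => exact hs
  | pair => exact lt_of_le_of_lt h hs
  | pairDisk => exact lt_of_le_of_lt h hs
  | tri => exact fun c => (hs c).imp fun p hp => ⟨hp.1, h.trans_lt hp.2⟩
  | triDisk => exact lt_of_le_of_lt h hs
  | returned => trivial

variable [NormedSpace ℝ V]

/-- The invariant of the algorithm: the current points are distinct points of `P`, two-point disks
and circumdisks have the values assigned to them, circumdisks belong to norm-acute triangles and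
have their center in the interior of the triangle, and a returned disk is the minimal enclosing
disk of `P`. -/
def Invariant (P : Finset V) : State V → Prop
  | .start => True
  | .pair p₁ p₂ => p₁ ∈ P ∧ p₂ ∈ P ∧ p₁ ≠ p₂
  | .pairDisk p₁ p₂ x r => p₁ ∈ P ∧ p₂ ∈ P ∧ p₁ ≠ p₂ ∧
      x = (1 / 2 : ℝ) • (p₁ + p₂) ∧ r = (1 / 2 : ℝ) * ‖p₁ - p₂‖
  | .tri p₁ p₂ p₃ => ({p₁, p₂, p₃} : Set V) ⊆ P ∧ p₁ ≠ p₂ ∧ p₁ ≠ p₃ ∧ p₂ ≠ p₃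
  | .triDisk p₁ p₂ p₃ x r => ({p₁, p₂, p₃} : Set V) ⊆ P ∧ NormAcute {p₁, p₂, p₃} ∧
      IsInnerCircumcenter x p₁ p₂ p₃ ∧ r = ‖x - p₁‖
  | .returned x r => IsMinDisk (P : Set V) x r

/-- An infinite run meets infinitely many candidate disks. -/
lemma exists_candidate_ge {P : Finset V} {s : ℕ → State V}
    (hs : ∀ n, Step P (s n) (s (n + 1))) (n : ℕ) :
    ∃ m, n ≤ m ∧ ∃ x r, (s m).candidate? = some (x, r) := by
  have pair : ∀ n p q, s n = .pair p q → ∃ m, n ≤ m ∧ ∃ x r, (s m).candidate? = some (x, r) := by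
    intro n p q h
    have h1 := hs n
    rw [h] at h1
    generalize ht : s (n + 1) = t at h1
    cases h1
    exact ⟨n + 1, n.le_succ, _, _, by rw [ht]; rfl⟩
  cases h : s n with
  | start =>
    have h1 := hs n
    rw [h] at h1
    generalize ht : s (n + 1) = t at h1
    cases h1
    obtain ⟨m, hm, hc⟩ := pair (n + 1) _ _ ht
    exact ⟨m, n.le_succ.trans hm, hc⟩
  | pair p q => exact pair n p q h
  | pairDisk => exact ⟨n, le_rfl, _, _, by rw [h]; rfl⟩
  | triDisk => exact ⟨n, le_rfl, _, _, by rw [h]; rfl⟩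
  | returned =>
    have h1 := hs n
    rw [h] at h1
    cases h1
  | tri =>
    have h1 := hs n
    rw [h] at h1
    generalize ht : s (n + 1) = t at h1
    cases h1 with
    | dropVertex =>
      obtain ⟨m, hm, hc⟩ := pair (n + 1) _ _ ht
      exact ⟨m, n.le_succ.trans hm, hc⟩
    | circumdisk => exact ⟨n + 1, n.le_succ, _, _, by rw [ht]; rfl⟩

variable [StrictConvexSpace ℝ V] {P : Finset V} {s t : State V}

lemma Invariant.exists_isMinDisk (hdim : Module.finrank ℝ V = 2) (hs : Invariant P s) {x : V}
    {r : ℝ} (hc : s.candidate? = some (x, r)) : ∃ S ⊆ (P : Set V), IsMinDisk S x r := by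
  cases s with
  | pairDisk p₁ p₂ y ρ =>
    obtain ⟨h₁, h₂, -, rfl, rfl⟩ := hs
    obtain ⟨rfl, rfl⟩ : _ ∧ _ := by simpa [State.candidate?] using hc
    refine ⟨{p₁, p₂}, ?_, by simpa using isMinDisk_pair p₁ p₂⟩
    rintro p (rfl | rfl)
    exacts [h₁, h₂]
  | triDisk p₁ p₂ p₃ y ρ =>
    obtain ⟨hP, -, h, rfl⟩ := hs
    obtain ⟨rfl, rfl⟩ : _ ∧ _ := by simpa [State.candidate?] using hc
    exact ⟨{p₁, p₂, p₃}, hP, h.isMinDisk hdim⟩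
  | _ => simp [State.candidate?] at hc

lemma Invariant.step (hdim : Module.finrank ℝ V = 2) (hs : Invariant P s) (hst : Step P s t) :
    Invariant P t := by
  cases hst with
  | choosePair p₁ p₂ h₁ h₂ hne => exact ⟨h₁, h₂, hne⟩
  | twoPointDisk p₁ p₂ => exact ⟨hs.1, hs.2.1, hs.2.2, rfl, rfl⟩
  | returnPair p₁ p₂ x r hall =>
    obtain ⟨S, hS, h⟩ := hs.exists_isMinDisk hdim rfl
    exact h.mono hS hall
  | chooseThird p₁ p₂ x r p₃ h₃ hout =>
    obtain ⟨h₁, h₂, hne, rfl, rfl⟩ := hs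
    have h := (isMinDisk_pair p₁ p₂).1
    refine ⟨?_, hne, ?_, ?_⟩
    · rintro p (rfl | rfl | rfl)
      exacts [h₁, h₂, h₃]
    · rintro rfl
      exact (h p₁ (by simp)).not_gt hout
    · rintro rfl
      exact (h p₂ (by simp)).not_gt hout
  | dropVertex p₁ p₂ p₃ v q₁ q₂ htype hq =>
    obtain ⟨a, b, ha, hb, hab, hT, -⟩ := exists_eq_triple_of_with htype
    have hqP : ({q₁, q₂} : Set V) ⊆ P := hq ▸ Set.sdiff_subset.trans hs.1
    refine ⟨hqP (by simp), hqP (by simp), ?_⟩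
    rintro rfl
    have hmem : ∀ y, v ≠ y → y ∈ ({v, a, b} : Set V) → y = q₁ := fun y hy hy' => by
      have : y ∈ ({q₁, q₁} : Set V) := hq ▸ hT ▸ ⟨hy', hy.symm⟩
      simpa using this
    exact hab ((hmem a ha (by simp)).trans (hmem b hb (by simp)).symm)
  | circumdisk p₁ p₂ p₃ x htype hx =>
    obtain ⟨hP, h₁₂, h₁₃, h₂₃⟩ := hs
    have hacute := normAcute_of_not_exists h₁₂ h₁₃ h₂₃ htype
    obtain ⟨y, hy⟩ := hacute.exists_isInnerCircumcenter hdim h₁₂ h₁₃ h₂₃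
    rw [hy.bisec_inter_bisec hdim, Set.singleton_eq_singleton_iff] at hx
    exact ⟨hP, hacute, hx ▸ hy, rfl⟩
  | returnTri p₁ p₂ p₃ x r hall =>
    obtain ⟨S, hS, h⟩ := hs.exists_isMinDisk hdim rfl
    exact h.mono hS hall
  | exchangeOff p₁ p₂ p₃ x r p₄ p₅ p₆ q₁ q₂ q₃ h₄ hout h₅ hmax hline h₆ hq =>
    obtain ⟨hP, -, h, rfl⟩ := hs
    have hle := (h.isMinDisk hdim).1
    have h₆' : p₆ ∈ ({p₁, p₂, p₃} : Set V) \ {p₅} :=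
      (h₆.symm ▸ Set.mem_singleton p₆ : p₆ ∈ {p ∈ ({p₁, p₂, p₃} : Set V) \ {p₅} | _}).1
    refine ⟨hq ▸ ?_, ne_of_insert_eq_insert hq ?_ ?_ (Ne.symm h₆'.2)⟩
    · rintro p (rfl | rfl | rfl)
      exacts [h₄, hP h₅, hP h₆'.1]
    · rintro rfl
      exact (hle p₄ h₅).not_gt hout
    · rintro rfl
      exact (hle p₄ h₆'.1).not_gt hout
  | exchangeOn p₁ p₂ p₃ x r p₄ p₅ p₆ q₁ q₂ q₃ h₄ hout h₅ hmax hline h₆ hq =>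
    obtain ⟨hP, -, h, rfl⟩ := hs
    have hle := (h.isMinDisk hdim).1
    refine ⟨hq ▸ ?_, ne_of_insert_eq_insert hq ?_ ?_ (Ne.symm h₆.2)⟩
    · rintro p (rfl | rfl | rfl)
      exacts [h₄, hP h₅, hP h₆.1]
    · rintro rfl
      exact (hle p₄ h₅).not_gt hout
    · rintro rfl
      exact (hle p₄ h₆.1).not_gt hout

lemma Invariant.of_reachable (hdim : Module.finrank ℝ V = 2) (h : Reachable P s) :
    Invariant P s := by
  induction h with
  | refl => trivial
  | tail _ hst ih => exact ih.step hdim hst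

/-- Testing a candidate disk and failing leads to points that need a larger radius. -/
lemma radiusExceeds_of_candidate_step (hdim : Module.finrank ℝ V = 2) (hs : Invariant P s)
    {x : V} {r : ℝ} (hc : s.candidate? = some (x, r)) (hst : Step P s t) :
    RadiusExceeds r t := by
  cases hst with
  | returnPair => trivial
  | returnTri => trivial
  | chooseThird p₁ p₂ x' r' p₃ h₃ hout =>
    obtain ⟨h₁, h₂, hne, rfl, rfl⟩ := hs
    obtain ⟨rfl, rfl⟩ := Prod.mk.inj (Option.some.inj hc)
    exact (isMinDisk_pair p₁ p₂).exists_lt (by rintro p (rfl | rfl) <;> simp) (by simp) hout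
  | exchangeOff p₁ p₂ p₃ x' r' p₄ p₅ p₆ q₁ q₂ q₃ h₄ hout h₅ hmax hline h₆ hq =>
    obtain ⟨-, -, h, rfl⟩ := hs
    obtain ⟨rfl, rfl⟩ := Prod.mk.inj (Option.some.inj hc)
    obtain ⟨h₆', hside⟩ : p₆ ∈ {p ∈ ({p₁, p₂, p₃} : Set V) \ {p₅} |
        (line[ℝ, p₅, x']).SOppSide p₄ p} := h₆.symm ▸ Set.mem_singleton p₆
    have hrad : ∀ p ∈ ({p₁, p₂, p₃} : Set V), ‖x' - p‖ = ‖x' - p₁‖ := by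
      rintro p (rfl | rfl | rfl)
      exacts [rfl, h.eq₁₂.symm, (h.eq₁₂.trans h.eq₂₃).symm]
    obtain ⟨p₇, h'⟩ := h.exists_of_mem_of_mem h₅ h₆'.1 h₆'.2
    obtain ⟨α, β, hαβ⟩ := exists_eq_smul_add_smul hdim h'.linearIndependent (p₄ - x')
    have hβ0 : β ≠ 0 := fun e =>
      hline ((mem_line_iff_coeff_eq_zero h'.linearIndependent hαβ).2 e)
    have hβ := (sOppSide_line_iff h'.linearIndependent hβ0 hαβ).1 hside
    intro c
    rw [hq]
    exact exists_lt_of_exchange hdim h.radius_pos (hrad p₅ h₅) (hrad p₆ h₆'.1) hout h'.ne₁₂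
      (neg_nonneg.2 hβ.le) (by rw [hαβ]; module) (hmax p₆ h₆'.1) c
  | exchangeOn p₁ p₂ p₃ x' r' p₄ p₅ p₆ q₁ q₂ q₃ h₄ hout h₅ hmax hline h₆ hq =>
    obtain ⟨-, -, h, rfl⟩ := hs
    obtain ⟨rfl, rfl⟩ := Prod.mk.inj (Option.some.inj hc)
    have hrad : ∀ p ∈ ({p₁, p₂, p₃} : Set V), ‖x' - p‖ = ‖x' - p₁‖ := by
      rintro p (rfl | rfl | rfl)
      exacts [rfl, h.eq₁₂.symm, (h.eq₁₂.trans h.eq₂₃).symm]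
    obtain ⟨k, hk⟩ := mem_line_iff.1 hline
    intro c
    rw [hq]
    exact exists_lt_of_exchange hdim h.radius_pos (hrad p₅ h₅) (hrad p₆ h₆.1) hout
      (Ne.symm h₆.2) le_rfl (by rw [hk]; module) (hmax p₆ h₆.1) c
  | _ => simp [State.candidate?] at hc

lemma RadiusExceeds.step (hdim : Module.finrank ℝ V = 2) {ρ : ℝ} (hρ : RadiusExceeds ρ s)
    (hs : Invariant P s) (hst : Step P s t) : RadiusExceeds ρ t := by
  cases s with
  | start => exact hρ.elim
  | pair => cases hst; exact hρ
  | pairDisk => exact (radiusExceeds_of_candidate_step hdim hs rfl hst).mono hρ.le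
  | triDisk => exact (radiusExceeds_of_candidate_step hdim hs rfl hst).mono hρ.le
  | returned => cases hst
  | tri p₁ p₂ p₃ =>
    cases hst with
    | circumdisk _ _ _ x htype hx =>
      obtain ⟨p, hp, hlt⟩ := hρ x
      obtain ⟨e, e'⟩ : x ∈ bisec p₁ p₂ ∩ bisec p₂ p₃ := hx.symm ▸ Set.mem_singleton x
      rcases hp with rfl | rfl | rfl
      exacts [hlt, hlt.trans_eq e.symm, hlt.trans_eq (e'.symm.trans e.symm)]
    | dropVertex _ _ _ v q₁ q₂ htype hq =>
      -- The two-point disk of `q₁` and `q₂` contains the removed vertex.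
      obtain ⟨a, b, ha, hb, hab, hT, hle⟩ := exists_eq_triple_of_with htype
      have hset : ({q₁, q₂} : Set V) = {a, b} := by
        rw [hq, hT, Set.insert_sdiff_of_mem _ (Set.mem_singleton v), Set.sdiff_singleton_eq_self]
        simp [ha, hb]
      have hlt : ρ < (1 / 2 : ℝ) * ‖a - b‖ := by
        obtain ⟨p, hp, hlt⟩ := hρ ((1 / 2 : ℝ) • (a + b))
        rw [hT] at hp
        rcases hp with rfl | hp
        · rw [norm_sub_rev] at hlt
          linarith
        · exact hlt.trans_le ((isMinDisk_pair a b).1 p hp)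
      rcases Set.pair_eq_pair_iff.1 hset with ⟨rfl, rfl⟩ | ⟨rfl, rfl⟩
      · exact hlt
      · rwa [norm_sub_rev] at hlt

lemma radius_lt_of_transGen (hdim : Module.finrank ℝ V = 2) {x x' : V} {r r' : ℝ}
    (hs : Reachable P s) (hst : Relation.TransGen (Step P) s t)
    (hc : s.candidate? = some (x, r)) (hc' : t.candidate? = some (x', r')) : r < r' := by
  have h : RadiusExceeds r t := by
    clear hc'
    induction hst with
    | single h => exact radiusExceeds_of_candidate_step hdim (.of_reachable hdim hs) hc h
    | tail h h' ih => exact ih.step hdim (.of_reachable hdim (hs.trans h.to_reflTransGen)) h'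
  cases t with
  | pairDisk =>
    obtain ⟨rfl, rfl⟩ := Prod.mk.inj (Option.some.inj hc')
    exact h
  | triDisk =>
    obtain ⟨rfl, rfl⟩ := Prod.mk.inj (Option.some.inj hc')
    exact h
  | _ => simp [State.candidate?] at hc'

lemma exists_step (hdim : Module.finrank ℝ V = 2) (hP : 2 ≤ P.card) (hs : Invariant P s) :
    (∃ x r, s = .returned x r) ∨ ∃ t, Step P s t := by
  cases s with
  | start =>
    obtain ⟨p₁, h₁, p₂, h₂, hne⟩ := Finset.one_lt_card.1 hP
    exact Or.inr ⟨_, .choosePair p₁ p₂ h₁ h₂ hne⟩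
  | pair p₁ p₂ => exact Or.inr ⟨_, .twoPointDisk p₁ p₂⟩
  | pairDisk p₁ p₂ x r =>
    right
    by_cases hall : ∀ p ∈ P, ‖x - p‖ ≤ r
    · exact ⟨_, .returnPair p₁ p₂ x r hall⟩
    · push Not at hall
      obtain ⟨p₃, h₃, hout⟩ := hall
      exact ⟨_, .chooseThird p₁ p₂ x r p₃ h₃ hout⟩
  | tri p₁ p₂ p₃ =>
    right
    obtain ⟨-, h₁₂, h₁₃, h₂₃⟩ := hs
    by_cases htype : ∃ v, NormObtuseWith {p₁, p₂, p₃} v ∨ NormRightWith {p₁, p₂, p₃} v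
    · obtain ⟨v, hv⟩ := htype
      obtain ⟨a, b, ha, hb, -, hT, -⟩ := exists_eq_triple_of_with hv
      refine ⟨_, .dropVertex p₁ p₂ p₃ v a b hv ?_⟩
      rw [hT, Set.insert_sdiff_of_mem _ (Set.mem_singleton v), Set.sdiff_singleton_eq_self]
      simp [ha, hb]
    · obtain ⟨x, hx⟩ := (normAcute_of_not_exists h₁₂ h₁₃ h₂₃ htype).exists_isInnerCircumcenter
        hdim h₁₂ h₁₃ h₂₃
      exact ⟨_, .circumdisk p₁ p₂ p₃ x htype (hx.bisec_inter_bisec hdim)⟩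
  | triDisk p₁ p₂ p₃ x r =>
    right
    by_cases hall : ∀ p ∈ P, ‖x - p‖ ≤ r
    · exact ⟨_, .returnTri p₁ p₂ p₃ x r hall⟩
    push Not at hall
    obtain ⟨p₄, h₄, hout⟩ := hall
    obtain ⟨-, -, h, -⟩ := hs
    obtain ⟨p₅, h₅, hmax⟩ := Set.exists_max_image ({p₁, p₂, p₃} : Set V) (fun p => ‖p₄ - p‖)
      (by simp) ⟨p₁, by simp⟩
    obtain ⟨b, c, h', hT⟩ := h.exists_of_mem h₅
    by_cases hline : p₄ ∈ line[ℝ, p₅, x]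
    · exact ⟨_, .exchangeOn p₁ p₂ p₃ x r p₄ p₅ b _ _ _ h₄ hout h₅ hmax hline
        (by rw [hT]; exact ⟨by simp, h'.ne₁₂.symm⟩) rfl⟩
    · obtain ⟨p₆, h₆⟩ := h'.exists_sep_sOppSide_eq hdim hline
      rw [← hT] at h₆
      exact ⟨_, .exchangeOff p₁ p₂ p₃ x r p₄ p₅ p₆ _ _ _ h₄ hout h₅ hmax hline h₆ rfl⟩
  | returned x r => exact Or.inl ⟨x, r, rfl⟩

/-- The candidate disks of an infinite run would be minimal enclosing disks of infinitely many
subsets of `P`, because their radii are different. -/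
lemma not_exists_infinite_run (hdim : Module.finrank ℝ V = 2) (P : Finset V) :
    ¬ ∃ s : ℕ → State V, s 0 = .start ∧ ∀ n, Step P (s n) (s (n + 1)) := by
  rintro ⟨s, h0, hs⟩
  have hreach : ∀ m n, m ≤ n → Relation.ReflTransGen (Step P) (s m) (s n) := by
    intro m n hmn
    induction hmn with
    | refl => exact .refl
    | step _ ih => exact ih.tail (hs _)
  have hR : ∀ n, Reachable P (s n) := fun n => by
    have := hreach 0 n n.zero_le
    rwa [h0] at this
  obtain ⟨φ, hφ, hcand⟩ := Filter.extraction_of_frequently_atTop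
    (Filter.frequently_atTop.2 (exists_candidate_ge hs))
  choose x r hc using hcand
  have hr : StrictMono r := strictMono_nat_of_lt_succ fun n =>
    radius_lt_of_transGen hdim (hR _)
      (.head' (hs _) (hreach _ _ (hφ n.lt_succ_self))) (hc n) (hc (n + 1))
  choose S hS hmin using fun n => (Invariant.of_reachable hdim (hR (φ n))).exists_isMinDisk hdim
    (hc n)
  have hinj : Function.Injective S := fun m n hmn =>
    hr.injective ((hmn ▸ hmin m : IsMinDisk (S n) (x m) (r m)).radius_unique (hmin n))
  exact Set.infinite_of_injective_forall_mem hinj hS P.finite_toSet.finite_subsets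

end Runs

end NormedPlane

theorem mainTheorem2 {V : Type*} [NormedAddCommGroup V] [NormedSpace ℝ V] [StrictConvexSpace ℝ V]
    (hdim : Module.finrank ℝ V = 2) (P : Finset V) (hP : 2 ≤ P.card) :
    -- every reachable state is a returned result or admits a next step
    (∀ s, NormedPlane.Reachable P s →
      (∃ x r, s = NormedPlane.State.returned x r) ∨ ∃ t, NormedPlane.Step P s t) ∧
    -- there is no infinite run
    (¬ ∃ s : ℕ → NormedPlane.State V, s 0 = NormedPlane.State.start ∧
      ∀ n, NormedPlane.Step P (s n) (s (n + 1))) ∧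
    -- a returned pair is the unique center and the radius of the minimal enclosing disk
    (∀ x r, NormedPlane.Reachable P (NormedPlane.State.returned x r) →
      NormedPlane.optCenters P = {x} ∧ NormedPlane.optRadius P = r) ∧
    -- circumdisks are computed for norm-acute triangles only
    (∀ p₁ p₂ p₃ x r, NormedPlane.Reachable P (NormedPlane.State.triDisk p₁ p₂ p₃ x r) →
      NormedPlane.NormAcute {p₁, p₂, p₃}) ∧
    -- the radii of successive candidate disks of a run strictly increase
    (∀ s t x r x' r', NormedPlane.Reachable P s →
      Relation.TransGen (NormedPlane.Step P) s t →
      s.candidate? = some (x, r) → t.candidate? = some (x', r') → r < r') := by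
  refine ⟨fun s hs => NormedPlane.exists_step hdim hP (.of_reachable hdim hs),
    NormedPlane.not_exists_infinite_run hdim P, fun x r h => ?_, fun p₁ p₂ p₃ x r h => ?_,
    fun s t x r x' r' hs hst hc hc' => NormedPlane.radius_lt_of_transGen hdim hs hst hc hc'⟩
  · have hmin : NormedPlane.IsMinDisk (P : Set V) x r := NormedPlane.Invariant.of_reachable hdim h
    exact ⟨hmin.optCenters_eq, hmin.optRadius_eq⟩
  · exact (NormedPlane.Invariant.of_reachable hdim h).2.1
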